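/- Let $G$ be a finite group and $A,B\subseteq G$ subgroups. All cochains are $\mathrm U(1)$-valued (trivial action), $d^{(n)}$ is the usual multiplicative coboundary, cochains are called normalised if they equal $1$ whenever an argument is an identity, and $x^y:=y^{-1}xy$. **Groupoids.** A group is identified with its one-object groupoid. For a groupoid $\mathcal G$, the loop groupoid $\Lambda\mathcal G$ has the endomorphisms of $\mathcal G$ as objects and morphisms $\mathfrak h:\mathfrak g\to\mathfrak h^{-1}\mathfrak g\mathfrak h$. For subgroupoids $\mathcal A,\mathcal B\subseteq\mathcal G$, the relative groupoid $\mathcal G_{\mathcal A\mathcal B}$ has as objects the morphisms $\mathfrak g$ of $\mathcal G$ with source in $\mathcal A$ and target in $\mathcal B$, and as morphisms $(\mathfrak a,\mathfrak b):\mathfrak g\to\mathfrak a^{-1}\mathfrak g\mathfrak b$ with $\mathfrak a$ in $\mathcal A$, $\mathfrak b$ in $\mathcal B$, composed componentwise. A $(\mathcal G,\alpha)$-subgroupoid, for a 3-cocycle $\alpha$ on $\mathcal G$, is a pair $(\mathcal A,\phi)$ with $\phi\in C^2(\mathcal A,\mathrm U(1))$ and $d^{(2)}\phi=\alpha^{-1}|_{\mathcal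 A}$. For two such pairs $(\mathcal A,\phi),(\mathcal B,\psi)$ put $$\vartheta_{\mathfrak g}(\mathfrak a,\mathfrak a'|\mathfrak b,\mathfrak b')=\frac{\psi(\mathfrak b,\mathfrak b')}{\phi(\mathfrak a,\mathfrak a')}\,\frac{\alpha(\mathfrak a,\mathfrak a',\mathfrak a'^{-1}\mathfrak a^{-1}\mathfrak g\mathfrak b\mathfrak b')\,\alpha(\mathfrak g,\mathfrak b,\mathfrak b')}{\alpha(\mathfrak a,\mathfrak a^{-1}\mathfrak g\mathfrak b,\mathfrak b')}.$$ The twisted groupoid algebra $\mathbb C[\mathcal G]^\vartheta$ is spanned by the morphisms of $\mathcal G$, with $|\mathfrak g\rangle\star|\mathfrak g'\rangle=\delta_{t(\mathfrak g),s(\mathfrak g')}\,\vartheta(\mathfrak g,\mathfrak g')\,|\mathfrak g\mathfrak g'\rangle$. **Tube algebras.** Let $\omega$ be a normalised $(d+1)$-cocycle on $G$ and $\phi\in C^d(A,\mathrm U(1))$, $\psi\in C^d(B,\mathrm U(1))$ normalised with $d^{(d)}\phi=\omega^{-1}|_A$, $d^{(d)}\psi=\omega^{-1}|_B$. For $d=2$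 let $Y=\mathbb I$ and for $d=3$ let $Y=\mathbb S^1\times\mathbb I$ (with one edge for $\mathbb S^1$ and one for $\mathbb I=[0,1]$); products of ordered simplices carry the staircase triangulation. A complex $X\times Y$ has physical boundary components $X\times\partial_0Y$ and $X\times\partial_1Y$, where $\partial_iY$ is the end $i\in\partial\mathbb I$ of $Y$. A colouring is a flat $G$-labelling of its edges, with labels in $A$ on the first and in $B$ on the second component. The tube is $\mathfrak T=(01)\times Y$, and the tube algebra is the span of the states $|c\rangle$, $c$ a colouring of $\mathfrak T$, with the product $\star$ defined as the composite of: (i) gluing, $|c\rangle\otimes|c'\rangle\mapsto$ the state of the glued colouring of $\mathfrak T\cup\mathfrak T=((01)\cup(12))\times Y$ if $c,c'$ agree on the interface, and $0$ otherwise; (ii) the ground state projector on $\mathfrak T\cup\mathfrak T$, which is the gapped-boundary Dijkgraaf–Witten partition function of the cobordism $\big((01\tilde1)^+\cup(1\tilde12)^-\big)\times Y$ from $((01)\cup(12))\times Y$ to $((0\tilde1)\cup(\tilde12))\times Y$; (iii) the triangulation-changing isomorphism given by the partition function of $(012)^+\times Y$ from $\mathfrak T\cup\mathfrak T$ to $\mathfrak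 T$. Here the partition function of a cobordism $M$ from $S$ to $T$, with time-like boundary components $\Omega_A,\Omega_B$ (induced orientation), has matrix elements $$\langle c_1|\mathcal Z[M]|c_0\rangle=\frac{1}{|G|^{\#M}|A|^{\#\Omega_A}|B|^{\#\Omega_B}}\sum_{c}\ \prod_{\Delta\subset\Omega_A}\phi(c[\Delta])^{\epsilon(\Delta)}\prod_{\Delta\subset\Omega_B}\psi(c[\Delta])^{\epsilon(\Delta)}\prod_{\Delta\subset M}\omega(c[\Delta])^{\epsilon(\Delta)},$$ summed over the colourings $c$ of $M$ restricting to $c_0$ on $S$ and $c_1$ on $T$, the products being over top-dimensional simplices; $\#$ is the number of interior vertices of $M$ (resp. $\Omega_A$, $\Omega_B$) plus half the numbers of interior vertices of $S$ and of $T$ (resp. of the parts of $\partial S$ and of $\partial T$ on that component). **Theorem.** 1. ((3+1)d.) Let $\pi$ be a normalised 4-cocycle on $G$ and $\lambda\in C^3(A,\mathrm U(1))$, $\mu\in C^3(B,\mathrm U(1))$ normalised with $d^{(3)}\lambda=\pi^{-1}|_A$, $d^{(3)}\mu=\pi^{-1}|_B$. Put, for a 3-cochain $\beta$, $$\mathsf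 T_x(\beta)(y_1,y_2)=\frac{\beta(x,y_1,y_2)\,\beta(y_1,y_2,x^{y_1y_2})}{\beta(y_1,x^{y_1},y_2)},$$ $$\mathsf T_x(\pi)(y_1,y_2,y_3)=\frac{\pi(y_1,x^{y_1},y_2,y_3)\,\pi(y_1,y_2,y_3,x^{y_1y_2y_3})}{\pi(x,y_1,y_2,y_3)\,\pi(y_1,y_2,x^{y_1y_2},y_3)}.$$ Then $\mathsf T(\pi)$ is a normalised 3-cocycle on $\Lambda G$; $d^{(2)}\mathsf T(\lambda)=\mathsf T(\pi)^{-1}|_{\Lambda A}$ and $d^{(2)}\mathsf T(\mu)=\mathsf T(\pi)^{-1}|_{\Lambda B}$, that is, $(\Lambda A,\mathsf T(\lambda))$ and $(\Lambda B,\mathsf T(\mu))$ are $(\Lambda G,\mathsf T(\pi))$-subgroupoids; and the associated $\vartheta=\vartheta^{\Lambda A\Lambda B}$ is a normalised 2-cocycle on $\Lambda G_{\Lambda A\Lambda B}$. The tube algebra of $\mathfrak T[\mathbb S^1\times\mathbb I]$ and the twisted relative groupoid algebra $\mathbb C[\Lambda G_{\Lambda A\Lambda B}]^{\vartheta}$ are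 associative and unital, and they are isomorphic. Explicitly, colourings of the tube correspond bijectively to morphisms of $\Lambda G_{\Lambda A\Lambda B}$: the colouring with labels $g=c(00')$, $a_2=c(0\tilde0)$, $b_2=c(0'\tilde0')$, $a_1=c(01)$, $b_1=c(0'1')$ (where $\tilde{}$ marks the $\mathbb S^1$ direction and $'$ the $\mathbb I$ direction of $Y$) corresponds to $(a_1,b_1)$ with source the object $a_2\xrightarrow{\,g\,}b_2$, and the linear map sending each state to $|A|^{-1/2}|B|^{-1/2}$ times the corresponding basis morphism is an algebra isomorphism. 2. ((2+1)d.) Let $\alpha$ be a normalised 3-cocycle on $G$ and $\phi\in C^2(A,\mathrm U(1))$, $\psi\in C^2(B,\mathrm U(1))$ normalised with $d^{(2)}\phi=\alpha^{-1}|_A$, $d^{(2)}\psi=\alpha^{-1}|_B$. Then $\vartheta^{AB}$, given by the same formula on the one-object groupoid $G$, is a normalised 2-cocycle on $G_{AB}$; the tube algebra of $\mathfrak T[\mathbb I]$ and $\mathbb C[G_{AB}]^{\alpha}_{\phi\psi}:=\mathbb C[G_{AB}]^{\vartheta^{AB}}$ are associative and unital; and they are isomorphic by the map sending the state with labels $g=c(00')$,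 $a=c(01)$, $b=c(0'1')$ to $|A|^{-1/2}|B|^{-1/2}$ times the morphism $(a,b):g\to a^{-1}gb$. 3. The groupoid $G_{AB}$ is isomorphic, by the identity on group elements, to the full subgroupoid of $\Lambda G_{\Lambda A\Lambda B}$ on the objects $a_2\xrightarrow{\,g\,}b_2$ with $a_2=b_2=1$. -/

import Mathlib

open CategoryTheory

namespace GappedTube

/-! ## Group cochains with values in `U(1)` -/

section GroupCochains

variable {G : Type*} [Group G]

/-- The coboundary `d^(n) : C^n(G, U(1)) → C^(n+1)(G, U(1))` for the trivial action, written
multiplicatively: `d f (g₀, …, gₙ)` is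
`f(g₁, …, gₙ) · ∏_{j < n} f(…, g_j g_{j+1}, …)^((-1)^(j+1)) · f(g₀, …, g_{n-1})^((-1)^(n+1))`
(the last index of `Fin.contractNth` drops the last entry). -/
noncomputable def coboundary {n : ℕ} (f : (Fin n → G) → Circle) (g : Fin (n + 1) → G) : Circle :=
  f (fun i => g i.succ) *
    ∏ j : Fin (n + 1), f (Fin.contractNth j (· * ·) g) ^ ((-1 : ℤ) ^ ((j : ℕ) + 1))

/-- A cochain is normalised if it is `1` as soon as one of its arguments is the unit. -/
def IsNormalized {n : ℕ} (f : (Fin n → G) → Circle) : Prop :=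
  ∀ g : Fin n → G, (∃ i, g i = 1) → f g = 1

/-- A normalised `n`-cocycle. -/
def IsNormalizedCocycle {n : ℕ} (f : (Fin n → G) → Circle) : Prop :=
  IsNormalized f ∧ ∀ g, coboundary f g = 1

/-- `(A, φ)` is a gapped boundary condition for the bulk cocycle `ω`: `φ` is a normalised cochain
on the subgroup `A` and `d φ` is the inverse of the restriction of `ω` to `A`. -/
def IsBoundaryCondition {n : ℕ} (ω : (Fin (n + 1) → G) → Circle) (A : Subgroup G)
    (φ : (Fin n → A) → Circle) : Prop :=
  IsNormalized φ ∧ ∀ a : Fin (n + 1) → A, coboundary φ a = (ω fun i => (a i : G))⁻¹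

/-- A cochain on a subgroup, evaluated on a tuple of elements of `G` (only its values on tuples in
`A` matter; it is set to `1` elsewhere). -/
noncomputable def evalOn {n : ℕ} (A : Subgroup G) (φ : (Fin n → A) → Circle) (g : Fin n → G) :
    Circle :=
  open Classical in if h : ∀ i, g i ∈ A then φ (fun i => ⟨g i, h i⟩) else 1

end GroupCochains

/-! ## Triangulations -/

/-- A finite triangulation (`Δ`-complex with branching structure) of pure dimension `m - 1`.
It is presented by the list of its top simplices, each one given by its sign and its `m` vertices
listed in increasing order, together with an identification: whenever all vertices of a simplex `σ`
are matched by `glue` with the corresponding vertices of a simplex `τ`, the simplices `σ` and `τ`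
are identified. -/
structure Complex (m : ℕ) (V : Type) where
  facets : List (ℤˣ × (Fin m → V))
  glue : V → V → Bool

namespace Complex

variable {m : ℕ} {V : Type}

/-- The simplices of the complex: the faces of its top simplices. -/
def IsSimplex (K : Complex m V) {k : ℕ} (σ : Fin k → V) : Prop :=
  ∃ f ∈ K.facets, ∃ ι : Fin k → Fin m, StrictMono ι ∧ ∀ i, σ i = f.2 (ι i)

/-- Two simplices represent the same simplex of the glued complex. -/
def Ident (K : Complex m V) {k : ℕ} (σ τ : Fin k → V) : Prop :=
  σ = τ ∨ (∀ i, K.glue (σ i) (τ i) = true) ∨ (∀ i, K.glue (τ i) (σ i) = true)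

instance [DecidableEq V] (K : Complex m V) {k : ℕ} (σ τ : Fin k → V) :
    Decidable (K.Ident σ τ) := by
  unfold Ident; infer_instance

/-- The list of the codimension one faces of all the top simplices (a face shared by two top
simplices appears twice). -/
def faces (K : Complex (m + 1) V) : List (Fin m → V) :=
  K.facets.flatMap fun f => (List.finRange (m + 1)).map fun i : Fin (m + 1) => fun j => f.2 (i.succAbove j)

/-- A codimension one face is on the boundary if it belongs to exactly one top simplex, after
identification. -/
def IsBoundaryFace [DecidableEq V] (K : Complex (m + 1) V) (τ : Fin m → V) : Prop :=
  K.faces.countP (fun σ => decide (K.Ident τ σ)) = 1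

/-- A vertex is interior if, after identification, it is not a vertex of a boundary face. -/
def IsInteriorVertex [DecidableEq V] (K : Complex (m + 1) V) (v : V) : Prop :=
  K.IsSimplex ![v] ∧
    ∀ τ ∈ K.faces, K.IsBoundaryFace τ → ∀ i, ¬ K.Ident ![τ i] ![v]

/-- The number of interior vertices, counted after identification. -/
noncomputable def numInterior [DecidableEq V] (K : Complex (m + 1) V) : ℕ :=
  (Quot.mk (fun v w => K.glue v w = true) '' {v | K.IsInteriorVertex v}).ncard

/-- The product `K × 𝕀`, with the staircase triangulation: `(v₀ … v_{m-1}) × 𝕀` is the union over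
`j` of the simplices `(v₀ … v_j v'_j … v'_{m-1})` with sign `(-1)^j`. The unprimed and primed copies
of a vertex `v` are `(v, false)` and `(v, true)`. -/
def prism (K : Complex m V) : Complex (m + 1) (V × Bool) where
  facets := K.facets.flatMap fun f => (List.finRange m).map fun j : Fin m =>
    (f.1 * (-1) ^ (j : ℕ), fun i => (f.2 (j.predAbove i), decide (j.castSucc < i)))
  glue v w := K.glue v.1 w.1 && (v.2 == w.2)

/-- The product `K × 𝕊¹`, for `K` a complex without identifications: the staircase triangulation of
`K × 𝕀` with the two copies `K × {0}` and `K × {1}` of `K` identified. -/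
def circle [DecidableEq V] (K : Complex m V) : Complex (m + 1) (V × Bool) where
  facets := K.prism.facets
  glue v w := (v.1 == w.1) && (v.2 == false) && (w.2 == true)

/-- For a complex whose physical boundary has two components, spanned by the vertices `(w, false)`
and by the vertices `(w, true)`: the component `b`, triangulated by the codimension one faces of `K`
that it contains, with the induced orientation. -/
def side {W : Type} (K : Complex (m + 1) (W × Bool)) (b : Bool) : Complex m (W × Bool) where
  facets := K.facets.flatMap fun f => (List.finRange (m + 1)).filterMap fun i : Fin (m + 1) =>
    if ∀ j, (f.2 (i.succAbove j)).2 = b then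
      some (f.1 * (-1) ^ (i : ℕ), fun j => f.2 (i.succAbove j)) else none
  glue := K.glue

end Complex

/-! ### One- and two-dimensional building blocks (all without identifications) -/

/-- The interval `(01)`. -/
def interval : Complex 2 (Fin 2) := ⟨[(1, ![0, 1])], fun _ _ => false⟩

/-- The interval subdivided at an interior vertex, `(01) ∪ (12)`. -/
def path : Complex 2 (Fin 3) := ⟨[(1, ![0, 1]), (1, ![1, 2])], fun _ _ => false⟩

/-- The triangle `(012)⁺`, a pinched interval cobordism from `(01) ∪ (12)` to `(02)`. -/
def triangle : Complex 3 (Fin 3) := ⟨[(1, ![0, 1, 2])], fun _ _ => false⟩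

/-- The pinched interval cobordism over `(01) ∪ (12)`. Its vertices `0 < 1 < 2 < 3` stand for
`0 < 1 < 1̃ < 2`: it is the union `(0 1 1̃)⁺ ∪ (1 1̃ 2)⁻`, from `(01) ∪ (12)` to
`(0 1̃) ∪ (1̃ 2)`. -/
def pinched : Complex 3 (Fin 4) := ⟨[(1, ![0, 1, 2]), (-1, ![1, 2, 3])], fun _ _ => false⟩

/-! ## Colourings -/

section Colourings

variable {G : Type*} [Group G]

/-- A `(G, A, B)`-colouring of a triangulation: an assignment of an element of `G` to every edge
`v < w`, flat on every triangle, compatible with the identifications, and with values in `A` and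
`B` on the edges in the first and the second component of the physical boundary. The value at a
pair that is not an edge carries no information and is fixed to be `1`. -/
structure Colouring {m : ℕ} {W : Type} (K : Complex m (W × Bool)) (A B : Subgroup G) where
  col : W × Bool → W × Bool → G
  flat : ∀ u v w, K.IsSimplex ![u, v, w] → col u v * col v w = col u w
  glued : ∀ v w v' w', K.IsSimplex ![v, w] → K.IsSimplex ![v', w'] →
    K.Ident ![v, w] ![v', w'] → col v w = col v' w'
  mem_A : ∀ v w, K.IsSimplex ![v, w] → v.2 = false → w.2 = false → col v w ∈ A
  mem_B : ∀ v w, K.IsSimplex ![v, w] → v.2 = true → w.2 = true → col v w ∈ B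
  off : ∀ v w, ¬ K.IsSimplex ![v, w] → col v w = 1

variable {A B : Subgroup G} {m m' : ℕ} {W W' : Type}

theorem Colouring.col_injective {K : Complex m (W × Bool)} :
    Function.Injective (Colouring.col : Colouring K A B → _) := by
  rintro ⟨c, _, _, _, _, _⟩ ⟨c', _, _, _, _, _⟩ h
  cases h
  rfl

instance [Finite G] [Finite W] (K : Complex m (W × Bool)) : Finite (Colouring K A B) :=
  Finite.of_injective _ Colouring.col_injective

noncomputable instance [Finite G] [Finite W] (K : Complex m (W × Bool)) :
    Fintype (Colouring K A B) :=
  Fintype.ofFinite _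

/-- The restriction `g[v₀ … v_n] = (g_{v₀v₁}, …, g_{v_{n-1}v_n})` of a colouring to a simplex. -/
def Colouring.on {K : Complex m (W × Bool)} (c : Colouring K A B) {n : ℕ}
    (σ : Fin (n + 1) → W × Bool) : Fin n → G :=
  fun i => c.col (σ i.castSucc) (σ i.succ)

/-- The colouring `c` restricts to the colouring `c₀` along the map of complexes induced by the
vertex map `s` (which preserves the physical boundary components). -/
def Colouring.RestrictsTo {L : Complex m' (W' × Bool)} {K : Complex m (W × Bool)}
    (c : Colouring L A B) (s : W → W') (c₀ : Colouring K A B) : Prop :=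
  ∀ v w, K.IsSimplex ![v, w] → c.col (s v.1, v.2) (s w.1, w.2) = c₀.col v w

/-- The space spanned by the graph-states `|c⟩` labelled by the colourings of `K`. -/
abbrev States {m : ℕ} {W : Type} (K : Complex m (W × Bool)) (A B : Subgroup G) : Type _ :=
  Colouring K A B →₀ ℂ

/-! ## The partition function -/

/-- A triangulated relative pinched interval cobordism from `S` to `T`, of spacetime dimension
`k + 2`: its bulk, and the inclusions of `S` and `T` as vertex maps. The time-like boundary has the
two components `bulk.side false` and `bulk.side true`. -/
structure Cobordism {k : ℕ} {U U' : Type} (S : Complex (k + 2) (U × Bool))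
    (T : Complex (k + 2) (U' × Bool)) (W : Type) where
  bulk : Complex (k + 3) (W × Bool)
  src : U → W
  tgt : U' → W

variable {k : ℕ} {U U' : Type} {S : Complex (k + 2) (U × Bool)} {T : Complex (k + 2) (U' × Bool)}

/-- The Boltzmann weight of a colouring `g`: the product of `φ(g[Δ])^ε(Δ)` and `ψ(g[Δ])^ε(Δ)` over
the top simplices of the two components of the time-like boundary and of `ω(g[Δ])^ε(Δ)` over the
top simplices of the bulk. -/
noncomputable def weight {K : Complex (k + 3) (W × Bool)} (ω : (Fin (k + 2) → G) → Circle)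
    (φ : (Fin (k + 1) → A) → Circle) (ψ : (Fin (k + 1) → B) → Circle) (c : Colouring K A B) :
    Circle :=
  (((K.side false).facets.map fun f => evalOn A φ (c.on f.2) ^ (f.1 : ℤ)).prod *
    ((K.side true).facets.map fun f => evalOn B ψ (c.on f.2) ^ (f.1 : ℤ)).prod) *
    (K.facets.map fun f => ω (c.on f.2) ^ (f.1 : ℤ)).prod

/-- Twice the exponent `#`, for a cobordism `M` between `S` and `T`:
`2 |int(M)⁰| + |int(T)⁰| + |int(S)⁰|`. -/
noncomputable def twiceExponent {m : ℕ} {V V₁ V₂ : Type} [DecidableEq V] [DecidableEq V₁]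
    [DecidableEq V₂] (M : Complex (m + 2) V) (S : Complex (m + 1) V₁) (T : Complex (m + 1) V₂) :
    ℕ :=
  2 * M.numInterior + T.numInterior + S.numInterior

/-- The normalisation `|G|^(-#M) |A|^(-#Ω_A) |B|^(-#Ω_B)` of the partition function. -/
noncomputable def normalisation [DecidableEq W] [DecidableEq U] [DecidableEq U']
    (M : Cobordism S T W) (A B : Subgroup G) : ℝ :=
  (√(Nat.card G : ℝ) ^ twiceExponent M.bulk S T *
    √(Nat.card A : ℝ) ^ twiceExponent (M.bulk.side false) (S.side false) (T.side false) *
    √(Nat.card B : ℝ) ^ twiceExponent (M.bulk.side true) (S.side true) (T.side true))⁻¹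

open Classical in
/-- The partition function of a relative pinched interval cobordism, as a linear operator from the
states on `S` to the states on `T`. -/
noncomputable def partitionFunction [Finite G] [DecidableEq W] [DecidableEq U] [DecidableEq U']
    [Finite W] [Finite U'] (ω : (Fin (k + 2) → G) → Circle) (φ : (Fin (k + 1) → A) → Circle)
    (ψ : (Fin (k + 1) → B) → Circle) (M : Cobordism S T W) : States S A B →ₗ[ℂ] States T A B :=
  Finsupp.linearCombination ℂ fun c₀ => (normalisation M A B : ℂ) •
    ∑ c : Colouring M.bulk A B, ∑ c₁ : Colouring T A B,
      if c.RestrictsTo M.src c₀ ∧ c.RestrictsTo M.tgt c₁ then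
        Finsupp.single c₁ (weight ω φ ψ c : ℂ) else 0

/-! ## Tube algebras -/

open Classical in
/-- The gluing map: `|c⟩ ⊗ |c'⟩` is sent to the state labelled by the colouring of the glued complex
`S = T ∪ T` that restricts to `c` and `c'` on the two copies of `T`, included along `ι₁` and `ι₂`,
and to `0` if `c` and `c'` do not agree on the gluing interface. -/
noncomputable def gluing [Finite G] [Finite U] (S : Complex (k + 2) (U × Bool))
    (T : Complex (k + 2) (U' × Bool)) (A B : Subgroup G) (ι₁ ι₂ : U' → U) :
    States T A B →ₗ[ℂ] States T A B →ₗ[ℂ] States S A B :=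
  Finsupp.linearCombination ℂ fun c => Finsupp.linearCombination ℂ fun c' =>
    ∑ e : Colouring S A B,
      if e.RestrictsTo ι₁ c ∧ e.RestrictsTo ι₂ c' then Finsupp.single e 1 else 0

/-- The `⋆`-product: gluing, followed by the ground state projector on the glued complex, followed
by the triangulation changing isomorphism. -/
noncomputable def starProduct [Finite G] {W₁ W₂ : Type} [DecidableEq W₁] [DecidableEq W₂]
    [DecidableEq U] [DecidableEq U'] [Finite W₁] [Finite W₂] [Finite U] [Finite U']
    (ω : (Fin (k + 2) → G) → Circle) (φ : (Fin (k + 1) → A) → Circle)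
    (ψ : (Fin (k + 1) → B) → Circle) (ι₁ ι₂ : U' → U) (P : Cobordism S S W₁)
    (Q : Cobordism S T W₂) : States T A B →ₗ[ℂ] States T A B →ₗ[ℂ] States T A B :=
  (gluing S T A B ι₁ ι₂).compr₂ (partitionFunction ω φ ψ Q ∘ₗ partitionFunction ω φ ψ P)

end Colourings

/-- The tube `𝔗[𝕀]` in `2+1` dimensions: the excitation boundary `𝕀` times the interval `(01)`.
The vertices `(i, false)`, `(i, true)` are `i`, `i'`; the physical boundary components are `(01)`
and `(0'1')`. -/
def tube2 : Complex 3 (Fin 2 × Bool) := interval.prism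

/-- The glued tube `𝔗[𝕀] ∪ 𝔗[𝕀]`. -/
def doubleTube2 : Complex 3 (Fin 3 × Bool) := path.prism

/-- The pinched interval cobordism that defines the ground state projector on the glued tube. -/
def projector2 : Cobordism doubleTube2 doubleTube2 (Fin 4) :=
  ⟨pinched.prism, ![0, 1, 3], ![0, 2, 3]⟩

/-- The pinched interval cobordism `(012)⁺ × 𝕀` from the glued tube to the tube. -/
def fusion2 : Cobordism doubleTube2 tube2 (Fin 3) := ⟨triangle.prism, id, ![0, 2]⟩

/-- The tube `𝔗[𝕊¹ × 𝕀]` in `3+1` dimensions: a cube with two opposite faces identified. The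
vertices `((i, false), false)`, `((i, true), false)`, `((i, false), true)`, `((i, true), true)` are
`i`, `ĩ`, `i'`, `ĩ'`; the physical boundary components are `(01) × 𝕊¹` and `(0'1') × 𝕊¹`. -/
def tube3 : Complex 4 ((Fin 2 × Bool) × Bool) := interval.circle.prism

/-- The glued tube `𝔗[𝕊¹ × 𝕀] ∪ 𝔗[𝕊¹ × 𝕀]`. -/
def doubleTube3 : Complex 4 ((Fin 3 × Bool) × Bool) := path.circle.prism

/-- The pinched interval cobordism that defines the ground state projector on the glued tube. -/
def projector3 : Cobordism doubleTube3 doubleTube3 (Fin 4 × Bool) :=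
  ⟨pinched.circle.prism, Prod.map ![0, 1, 3] id, Prod.map ![0, 2, 3] id⟩

/-- The pinched interval cobordism `(012)⁺ × 𝕊¹ × 𝕀` from the glued tube to the tube. -/
def fusion3 : Cobordism doubleTube3 tube3 (Fin 3 × Bool) :=
  ⟨triangle.circle.prism, id, Prod.map ![0, 2] id⟩

section TubeAlgebras

variable {G : Type*} [Group G] [Finite G] {A B : Subgroup G}

/-- The product of the `(2+1)`-dimensional tube algebra for `(G, α)` and gapped boundaries
`(A, φ)`, `(B, ψ)`. -/
noncomputable def tubeProduct2 (α : (Fin 3 → G) → Circle) (φ : (Fin 2 → A) → Circle)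
    (ψ : (Fin 2 → B) → Circle) :
    States tube2 A B →ₗ[ℂ] States tube2 A B →ₗ[ℂ] States tube2 A B :=
  starProduct α φ ψ ![0, 1] ![1, 2] projector2 fusion2

/-- The product of the `(3+1)`-dimensional tube algebra for `(G, π)` and gapped boundaries
`(A, l)`, `(B, m)`. -/
noncomputable def tubeProduct3 (π : (Fin 4 → G) → Circle) (l : (Fin 3 → A) → Circle)
    (m : (Fin 3 → B) → Circle) :
    States tube3 A B →ₗ[ℂ] States tube3 A B →ₗ[ℂ] States tube3 A B :=
  starProduct π l m (Prod.map ![0, 1] id) (Prod.map ![1, 2] id) projector3 fusion3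

end TubeAlgebras

/-! ## Groupoids, their cochains and their twisted algebras -/

section GroupoidCochains

universe v u

/-- `U(1)`-valued `2`-cochains. -/
abbrev Cochain2 (C : Type u) [Category.{v} C] :=
  ∀ ⦃X Y Z : C⦄, (X ⟶ Y) → (Y ⟶ Z) → Circle

/-- `U(1)`-valued `3`-cochains. -/
abbrev Cochain3 (C : Type u) [Category.{v} C] :=
  ∀ ⦃X Y Z W : C⦄, (X ⟶ Y) → (Y ⟶ Z) → (Z ⟶ W) → Circle

variable {C : Type u} [Category.{v} C]

/-- The coboundary of a `2`-cochain. -/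
noncomputable def d2 (φ : Cochain2 C) : Cochain3 C := fun _ _ _ _ f g h =>
  φ g h * φ f (g ≫ h) / (φ (f ≫ g) h * φ f g)

/-- The coboundary of a `3`-cochain. -/
noncomputable def d3 (α : Cochain3 C) {X Y Z W T : C} (f : X ⟶ Y) (g : Y ⟶ Z) (h : Z ⟶ W)
    (k : W ⟶ T) : Circle :=
  α g h k * α f (g ≫ h) k * α f g h / (α (f ≫ g) h k * α f g (h ≫ k))

/-- Normalised `2`-cocycles. -/
structure IsNormalizedCocycle2 (θ : Cochain2 C) : Prop where
  cocycle : ∀ ⦃X Y Z W : C⦄ (f : X ⟶ Y) (g : Y ⟶ Z) (h : Z ⟶ W), d2 θ f g h = 1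
  id_left : ∀ ⦃X Y : C⦄ (f : X ⟶ Y), θ (𝟙 X) f = 1
  id_right : ∀ ⦃X Y : C⦄ (f : X ⟶ Y), θ f (𝟙 Y) = 1

/-- Normalised `3`-cocycles. -/
structure IsNormalizedCocycle3 (α : Cochain3 C) : Prop where
  cocycle : ∀ ⦃X Y Z W T : C⦄ (f : X ⟶ Y) (g : Y ⟶ Z) (h : Z ⟶ W) (k : W ⟶ T),
    d3 α f g h k = 1
  id_left : ∀ ⦃X Y Z : C⦄ (f : X ⟶ Y) (g : Y ⟶ Z), α (𝟙 X) f g = 1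
  id_mid : ∀ ⦃X Y Z : C⦄ (f : X ⟶ Y) (g : Y ⟶ Z), α f (𝟙 Y) g = 1
  id_right : ∀ ⦃X Y Z : C⦄ (f : X ⟶ Y) (g : Y ⟶ Z), α f g (𝟙 Z) = 1

/-- A morphism of `C` together with its source and target. -/
structure Mor (C : Type u) [Category.{v} C] where
  {src : C}
  {tgt : C}
  hom : src ⟶ tgt

open Classical in
/-- The product `|f⟩ ⋆ |g⟩ = δ_{t(f), s(g)} θ(f, g) |f g⟩` on the space spanned by the morphisms of
`C`: the product of the twisted groupoid algebra `ℂ[C]^θ`. -/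
noncomputable def twistedProduct (θ : Cochain2 C) :
    (Mor C →₀ ℂ) →ₗ[ℂ] (Mor C →₀ ℂ) →ₗ[ℂ] (Mor C →₀ ℂ) :=
  Finsupp.linearCombination ℂ fun f => Finsupp.linearCombination ℂ fun g =>
    if h : f.tgt = g.src then
      Finsupp.single ⟨f.hom ≫ eqToHom h ≫ g.hom⟩ (θ f.hom (eqToHom h ≫ g.hom) : ℂ)
    else 0

/-- A bilinear product is associative and has a two-sided unit. -/
def IsUnitalAssoc {M : Type*} [AddCommGroup M] [Module ℂ M] (p : M →ₗ[ℂ] M →ₗ[ℂ] M) : Prop :=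
  (∀ x y z, p (p x y) z = p x (p y z)) ∧ ∃ e, ∀ x, p e x = x ∧ p x e = x

end GroupoidCochains

section RelativeGroupoid

universe v u

variable {C : Type u} [Groupoid.{v} C]

/-- `(S, φ)` is a `(C, α)`-subgroupoid: `d φ` is the inverse of the restriction of `α` to `S`. -/
def IsTwistedSubgroupoid (α : Cochain3 C) (S : Subgroupoid C) (φ : Cochain2 S.objs) : Prop :=
  ∀ ⦃X Y Z W : S.objs⦄ (f : X ⟶ Y) (g : Y ⟶ Z) (h : Z ⟶ W),
    d2 φ f g h = (α (S.hom.map f) (S.hom.map g) (S.hom.map h))⁻¹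

/-- The relative groupoid `C_{S T}`. Its objects are the morphisms `g : X ⟶ Y` of `C` with source in
`S` and target in `T`; its morphisms from `g` to `g'` are the pairs `(a, b)` of a morphism `a` of
`S` and a morphism `b` of `T` with `g b = a g'`, that is, `g' = a⁻¹ g b`. -/
abbrev RelGroupoid (S T : Subgroupoid C) := Comma S.hom T.hom

noncomputable instance (S T : Subgroupoid C) : Groupoid (RelGroupoid S T) where
  inv f :=
    { left := Groupoid.inv f.left
      right := Groupoid.inv f.right
      w := by
        have := f.w
        simp only [Groupoid.inv_eq_inv, Functor.map_inv]
        rw [IsIso.inv_comp_eq, ← Category.assoc, IsIso.eq_comp_inv, this] }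

/-- The `2`-cochain
`ϑ_g(a, a' | b, b') = ψ(b, b') / φ(a, a') · α(a, a', a'⁻¹a⁻¹gbb') α(g, b, b') / α(a, a⁻¹gb, b')`
on the relative groupoid. -/
noncomputable def relTwist {S T : Subgroupoid C} (α : Cochain3 C) (φ : Cochain2 S.objs)
    (ψ : Cochain2 T.objs) : Cochain2 (RelGroupoid S T) := fun X Y Z f f' =>
  ψ f.right f'.right / φ f.left f'.left *
    (α (S.hom.map f.left) (S.hom.map f'.left) Z.hom *
      α X.hom (T.hom.map f.right) (T.hom.map f'.right) /
      α (S.hom.map f.left) Y.hom (T.hom.map f'.right))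

end RelativeGroupoid

section Loop

universe v u

/-- The loop groupoid `Λ C`: its objects are the endomorphisms in `C`. -/
structure Loop (C : Type u) [Category.{v} C] where
  base : C
  loop : base ⟶ base

/-- The morphisms of the loop groupoid from `g` to `g'` are the morphisms `h` of `C` with
`g h = h g'`, that is, `g' = h⁻¹ g h`. -/
@[ext]
structure Loop.Hom {C : Type u} [Category.{v} C] (x y : Loop C) where
  map : x.base ⟶ y.base
  comm : x.loop ≫ map = map ≫ y.loop

instance {C : Type u} [Groupoid.{v} C] : Groupoid (Loop C) where
  Hom := Loop.Hom
  id x := ⟨𝟙 x.base, by simp⟩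
  comp f g := ⟨f.map ≫ g.map, by
    rw [← Category.assoc, f.comm, Category.assoc, g.comm, Category.assoc]⟩
  id_comp f := Loop.Hom.ext (Category.id_comp f.map)
  comp_id f := Loop.Hom.ext (Category.comp_id f.map)
  assoc f g h := Loop.Hom.ext (Category.assoc f.map g.map h.map)
  inv f := ⟨Groupoid.inv f.map, by
    rw [Groupoid.inv_eq_inv, IsIso.eq_inv_comp, ← Category.assoc, ← f.comm, Category.assoc,
      IsIso.hom_inv_id, Category.comp_id]⟩
  inv_comp f := Loop.Hom.ext (Groupoid.inv_comp f.map)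
  comp_inv f := Loop.Hom.ext (Groupoid.comp_inv f.map)

/-- The loop groupoid `Λ S` of a subgroupoid `S` of `C`, as a subgroupoid of `Λ C`. -/
def loopSubgroupoid {C : Type u} [Groupoid.{v} C] (S : Subgroupoid C) : Subgroupoid (Loop C) where
  arrows x y := {h | x.loop ∈ S.arrows x.base x.base ∧ h.map ∈ S.arrows x.base y.base}
  inv := by
    rintro x y p ⟨h₁, h₂⟩
    refine ⟨?_, S.inv h₂⟩
    rw [← S.mul_mem_cancel_left h₂, ← p.comm]
    exact S.mul h₁ h₂
  mul := by
    rintro x y z p ⟨h₁, h₂⟩ q ⟨_, h₄⟩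
    exact ⟨h₁, S.mul h₂ h₄⟩

end Loop

/-! ### Deloopings of groups -/

section Deloop

/-- The delooping of a group `G`: one object, the elements of `G` as morphisms, and composition
`f ≫ g = f * g`. -/
structure Deloop (G : Type*) : Type where

instance {G : Type*} [Group G] : Groupoid (Deloop G) where
  Hom _ _ := G
  id _ := (1 : G)
  comp f g := (f * g : G)
  id_comp f := one_mul (M := G) f
  comp_id f := mul_one (M := G) f
  assoc f g h := mul_assoc (G := G) f g h
  inv f := (f⁻¹ : G)
  inv_comp f := inv_mul_cancel (G := G) f
  comp_inv f := mul_inv_cancel (G := G) f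

variable {G : Type*} [Group G]

/-- The group element underlying a morphism of the delooping. -/
def Deloop.elt {X Y : Deloop G} (f : X ⟶ Y) : G := f

/-- The delooping of a subgroup, as a subgroupoid. -/
def deloopSubgroup (A : Subgroup G) : Subgroupoid (Deloop G) where
  arrows _ _ := {f | Deloop.elt f ∈ A}
  inv h := A.inv_mem h
  mul h _ h' := A.mul_mem h h'

/-- The loop groupoid `Λ G` of (the delooping of) a group. -/
abbrev LoopG (G : Type*) [Group G] := Loop (Deloop G)

/-- The subgroupoid `Λ A` of `Λ G`. -/
abbrev loopA (A : Subgroup G) : Subgroupoid (LoopG G) := loopSubgroupoid (deloopSubgroup A)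

/-- The group element of an object of `Λ G`. -/
def fluxG (x : LoopG G) : G := Deloop.elt x.loop

/-- The group element of a morphism of `Λ G`. -/
def eltG {x y : LoopG G} (f : x ⟶ y) : G := Deloop.elt f.map

/-- The element of `A` of an object of `Λ A`. -/
def fluxA {A : Subgroup G} (x : (loopA A).objs) : A := ⟨fluxG x.1, x.2.choose_spec.1⟩

/-- The element of `A` of a morphism of `Λ A`. -/
def eltA {A : Subgroup G} {x y : (loopA A).objs} (f : x ⟶ y) : A := ⟨eltG f.1, f.2.2⟩

/-- The element of `A` of a morphism of the delooping of `A`. -/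
def eltD {A : Subgroup G} {x y : (deloopSubgroup A).objs} (f : x ⟶ y) : A :=
  ⟨Deloop.elt f.1, f.2⟩

/-- A group `3`-cochain as a `3`-cochain on the delooping. -/
def deloop3 (α : (Fin 3 → G) → Circle) : Cochain3 (Deloop G) := fun _ _ _ _ f g h =>
  α ![Deloop.elt f, Deloop.elt g, Deloop.elt h]

/-- A `2`-cochain on a subgroup as a `2`-cochain on its delooping. -/
def deloop2 {A : Subgroup G} (φ : (Fin 2 → A) → Circle) : Cochain2 (deloopSubgroup A).objs :=
  fun _ _ _ f g => φ ![eltD f, eltD g]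

end Deloop

/-! ### Transgression -/

section Transgression

variable {H : Type*} [Group H]

/-- `T_x(α)(y₁, y₂) = α(x, y₁, y₂) α(y₁, y₂, x^{y₁y₂}) / α(y₁, x^{y₁}, y₂)`, with
`x^y = y⁻¹ x y`. -/
noncomputable def transgress3 (α : (Fin 3 → H) → Circle) (x y₁ y₂ : H) : Circle :=
  α ![x, y₁, y₂] * α ![y₁, y₂, (y₁ * y₂)⁻¹ * x * (y₁ * y₂)] /
    α ![y₁, y₁⁻¹ * x * y₁, y₂]

/-- `T_x(π)(y₁, y₂, y₃) = π(y₁, x^{y₁}, y₂, y₃) π(y₁, y₂, y₃, x^{y₁y₂y₃}) /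
(π(x, y₁, y₂, y₃) π(y₁, y₂, x^{y₁y₂}, y₃))`. -/
noncomputable def transgress4 (π : (Fin 4 → H) → Circle) (x y₁ y₂ y₃ : H) : Circle :=
  π ![y₁, y₁⁻¹ * x * y₁, y₂, y₃] *
      π ![y₁, y₂, y₃, (y₁ * y₂ * y₃)⁻¹ * x * (y₁ * y₂ * y₃)] /
    (π ![x, y₁, y₂, y₃] * π ![y₁, y₂, (y₁ * y₂)⁻¹ * x * (y₁ * y₂), y₃])

variable {G : Type*} [Group G]

/-- The transgression `T(π)`, a `3`-cochain on `Λ G`. -/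
noncomputable def T4 (π : (Fin 4 → G) → Circle) : Cochain3 (LoopG G) := fun x _ _ _ f g h =>
  transgress4 π (fluxG x) (eltG f) (eltG g) (eltG h)

/-- The transgression `T(l)` of a `3`-cochain on a subgroup `A`, a `2`-cochain on `Λ A`. -/
noncomputable def T3 {A : Subgroup G} (l : (Fin 3 → A) → Circle) : Cochain2 (loopA A).objs :=
  fun x _ _ f g => transgress3 l (fluxA x) (eltA f) (eltA g)

/-- The twisting `2`-cochain `ϑ^{ΛA ΛB}` on the relative groupoid `ΛG_{ΛA ΛB}`. -/
noncomputable def loopTwist {A B : Subgroup G} (π : (Fin 4 → G) → Circle)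
    (l : (Fin 3 → A) → Circle) (m : (Fin 3 → B) → Circle) :
    Cochain2 (RelGroupoid (loopA A) (loopA B)) :=
  relTwist (T4 π) (T3 l) (T3 m)

/-- The twisting `2`-cochain `ϑ^{AB}` on the relative groupoid `G_{AB}`. -/
noncomputable def groupTwist {A B : Subgroup G} (α : (Fin 3 → G) → Circle)
    (φ : (Fin 2 → A) → Circle) (ψ : (Fin 2 → B) → Circle) :
    Cochain2 (RelGroupoid (deloopSubgroup A) (deloopSubgroup B)) :=
  relTwist (deloop3 α) (deloop2 φ) (deloop2 ψ)

end Transgression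

end GappedTube

namespace GappedTube

/-! ## Simplices of prisms -/

namespace Complex

variable {m : ℕ} {V V' : Type}

/-! Every complex in the construction is `K × 𝕀` or `K × 𝕊¹ × 𝕀`, where `K` is a chain: its vertices
are `0 < 1 < … < n` and its simplices are spanned by consecutive edges. Put `H = A × B`. A flat
colouring of such a product is determined by its labels over vertex `0` (an element `g`, together
with a monodromy `z` around the circle in the second case) and by one element of `H` for each edge
`(i, i+1)`. Flatness on the squares over these edges determines all other labels, and the data are
unconstrained apart from `z ∈ A` and `g⁻¹zg ∈ B`. Hence colourings are chains of `n` composable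
morphisms of an action groupoid of `H`, and this groupoid is the relative groupoid. A chain is
recorded by its starting object `x` and its composites `P i`, that is, by a potential on the
vertices. Left translation of `P` moves the starting object (`chainColouring_translate`,
`loopChainColouring_translate`).

The weights reduce to a single computation. The weight of the prism over the triangle `(012)` is `ϑ`
(`potentialWeight_triangle_prism`, `potentialWeight_triangle_circle_prism`). The projector cobordism
is the difference of two triangles, so its weight is a quotient of two values of `ϑ`
(`potentialWeight_eq_div`).

In the product of two basis states, gluing imposes composability `x·h = x'`. The projector sums over
the new position `j ∈ H` of the middle vertex, with weight `ϑ_x(h, h⁻¹j) / ϑ_{x·h}(h⁻¹j, j⁻¹hh')`,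
and the change of triangulation contributes `ϑ_x(j, j⁻¹hh')`. By the cocycle identity each term
equals `ϑ_x(h, h')`, whatever `j` is. The `|A||B|` equal terms cancel the normalisation of the
projector, and the change of triangulation leaves `N = |A|^{-1/2}|B|^{-1/2}`. The structure
constants are thus `N` times those of the groupoid algebra, and rescaling basis vectors by `N` gives
the isomorphism, along which associativity and the unit are transported.

The cocycle properties of `T(π)` and `ϑ`, and the boundary equations for `T(λ)`, `T(μ)`, are prism
arguments: an alternating combination of the given coboundary equations with one extra argument
inserted in every possible position. Finally, `G_{AB}` sits in the loop version as the part with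
trivial loops. -/

theorem IsSimplex.comp {K : Complex m V} {k l : ℕ} {σ : Fin k → V} (h : K.IsSimplex σ)
    {κ : Fin l → Fin k} (hκ : StrictMono κ) : K.IsSimplex (σ ∘ κ) := by
  obtain ⟨f, hf, ι, hι, hσ⟩ := h
  exact ⟨f, hf, ι ∘ κ, hι.comp hκ, fun i => hσ (κ i)⟩

theorem isSimplex_facet {K : Complex m V} {f : ℤˣ × (Fin m → V)} (hf : f ∈ K.facets) {k : ℕ}
    {ι : Fin k → Fin m} (hι : StrictMono ι) : K.IsSimplex (f.2 ∘ ι) :=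
  ⟨f, hf, ι, hι, fun _ => rfl⟩

theorem strictMono_pair {k : ℕ} {i j : Fin k} (h : i < j) : StrictMono ![i, j] := by
  intro a b hab
  fin_cases a <;> fin_cases b <;> simp_all

theorem strictMono_triple {k : ℕ} {i j l : Fin k} (h : i < j) (h' : j < l) :
    StrictMono ![i, j, l] := by
  intro a b hab
  have := h.trans h'
  fin_cases a <;> fin_cases b <;> simp_all

theorem isSimplex_pair_facet {K : Complex m V} {f : ℤˣ × (Fin m → V)} (hf : f ∈ K.facets)
    {i j : Fin m} (h : i < j) : K.IsSimplex ![f.2 i, f.2 j] :=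
  ⟨f, hf, ![i, j], strictMono_pair h, fun i => by fin_cases i <;> rfl⟩

theorem isSimplex_pair_iff {K : Complex m V} {v w : V} :
    K.IsSimplex ![v, w] ↔ ∃ f ∈ K.facets, ∃ i j, i < j ∧ f.2 i = v ∧ f.2 j = w := by
  constructor
  · rintro ⟨f, hf, ι, hι, h⟩
    exact ⟨f, hf, ι 0, ι 1, hι (by decide), (h 0).symm, (h 1).symm⟩
  · rintro ⟨f, hf, i, j, hij, rfl, rfl⟩
    exact isSimplex_pair_facet hf hij

theorem isSimplex_triple_facet {K : Complex m V} {f : ℤˣ × (Fin m → V)} (hf : f ∈ K.facets)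
    {i j l : Fin m} (h : i < j) (h' : j < l) : K.IsSimplex ![f.2 i, f.2 j, f.2 l] :=
  ⟨f, hf, ![i, j, l], strictMono_triple h h', fun i => by fin_cases i <;> rfl⟩

theorem IsSimplex.pair_of_triple {K : Complex m V} {u v w : V} (h : K.IsSimplex ![u, v, w]) :
    K.IsSimplex ![u, v] ∧ K.IsSimplex ![v, w] ∧ K.IsSimplex ![u, w] := by
  obtain ⟨f, hf, ι, hι, h⟩ := h
  have h0 := h 0
  have h1 := h 1
  have h2 := h 2
  simp only [Matrix.cons_val_zero, Matrix.cons_val_one, Matrix.cons_val] at h0 h1 h2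
  subst h0 h1 h2
  exact ⟨isSimplex_pair_facet hf (hι (by decide)), isSimplex_pair_facet hf (hι (by decide)),
    isSimplex_pair_facet hf (hι (by decide))⟩

/-- The simplices of a prism over a facet `f` are the staircases in `f × 𝕀`: they cross over from
the unprimed to the primed copy at a vertex `p` of `f`. -/
theorem isSimplex_prism_iff {K : Complex m V} {k : ℕ} {σ : Fin k → V × Bool} :
    K.prism.IsSimplex σ ↔ ∃ f ∈ K.facets, ∃ (p : Fin m) (ι : Fin k → Fin m),
      (∀ i j, i < j → ι i < ι j ∨ ι i = ι j ∧ (σ i).2 = false ∧ (σ j).2 = true) ∧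
      (∀ i, (σ i).1 = f.2 (ι i)) ∧ (∀ i j, i < j → (σ i).2 = true → (σ j).2 = true) ∧
      ∀ i, ((σ i).2 = false → ι i ≤ p) ∧ ((σ i).2 = true → p ≤ ι i) := by
  constructor
  · rintro ⟨F, hF, κ, hκ, hσ⟩
    simp only [prism, List.mem_flatMap, List.mem_map, List.mem_finRange, true_and] at hF
    obtain ⟨f, hf, p, rfl⟩ := hF
    -- The facet of the prism with step at `p` repeats the vertex `p`; `p.predAbove` is the
    -- projection that forgets the repetition.
    refine ⟨f, hf, p, fun i => p.predAbove (κ i), ?_, fun i => by rw [hσ], ?_, ?_⟩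
    · intro i j hij
      have h := hκ hij
      have h' := (Fin.predAbove_right_monotone p) h.le
      rcases lt_or_eq_of_le h' with h' | h'
      · exact Or.inl h'
      · refine Or.inr ⟨h', ?_⟩
        simp only [hσ, decide_eq_false_iff_not, decide_eq_true_eq, not_lt]
        simp only [Fin.lt_def, Fin.le_def, Fin.ext_iff, Fin.predAbove, Fin.val_castSucc] at *
        split_ifs at h' <;> simp at * <;> omega
    · intro i j hij h
      simp only [hσ, decide_eq_true_eq] at h ⊢
      exact h.trans (hκ hij)
    · intro i
      simp only [hσ, decide_eq_false_iff_not, decide_eq_true_eq, not_lt]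
      refine ⟨fun h => ?_, fun h => ?_⟩
      · rw [Fin.predAbove_of_le_castSucc _ _ h]
        exact Fin.le_def.2 h
      · rw [Fin.predAbove_of_castSucc_lt _ _ h]
        have h' : (p : ℕ) < κ i := h
        exact Fin.le_def.2 (by rw [Fin.val_pred]; omega)
  · rintro ⟨f, hf, p, ι, hι, hσ, hb, hp⟩
    -- Conversely, unprimed vertices keep their index and primed ones are shifted by one, past the
    -- repeated vertex `p`.
    refine ⟨_, List.mem_flatMap.2 ⟨f, hf, List.mem_map.2 ⟨p, List.mem_finRange p, rfl⟩⟩,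
      fun i => bif (σ i).2 then (ι i).succ else (ι i).castSucc, ?_, ?_⟩
    · intro i j hij
      have h1 := hι i j hij
      have h2 := hb i j hij
      have h3 := hp i
      have h4 := hp j
      simp only [Fin.lt_def, Fin.le_def, Fin.ext_iff] at *
      rcases hi : (σ i).2 <;> rcases hj : (σ j).2 <;> simp_all
      omega
    · intro i
      have h3 := hp i
      refine Prod.ext ?_ ?_
      · rw [hσ]
        rcases hi : (σ i).2 <;> simp only [hi, cond_false, cond_true]
        · rw [Fin.predAbove_castSucc_of_le _ _ (h3.1 hi)]
        · rw [Fin.predAbove_succ_of_le _ _ (h3.2 hi)]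
      · rcases hi : (σ i).2 <;> simp only [hi, cond_false, cond_true]
        · simpa using h3.1 hi
        · simpa [Fin.castSucc_lt_succ_iff] using h3.2 hi

/-- The staircase description is functorial: a map sending facets to simplices carries the crossing
vertex `p` to `κ p`. Applied twice, this handles `K × 𝕊¹ × 𝕀`. -/
theorem IsSimplex.prism_map {m' : ℕ} {K : Complex m V} {L : Complex m' V'} {s : V → V'}
    (hs : ∀ f ∈ K.facets, L.IsSimplex (s ∘ f.2)) {k : ℕ} {σ : Fin k → V × Bool}
    (h : K.prism.IsSimplex σ) : L.prism.IsSimplex (fun i => (s (σ i).1, (σ i).2)) := by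
  obtain ⟨f, hf, p, ι, hι, hσ, hb, hp⟩ := isSimplex_prism_iff.1 h
  obtain ⟨f', hf', κ, hκ, hs⟩ := hs f hf
  refine isSimplex_prism_iff.2 ⟨f', hf', κ p, κ ∘ ι, ?_, ?_, hb, ?_⟩
  · intro i j hij
    rcases hι i j hij with h | h
    · exact Or.inl (hκ h)
    · exact Or.inr ⟨congrArg κ h.1, h.2⟩
  · intro i
    have := hs (ι i)
    simp only [Function.comp_apply] at this ⊢
    rw [← this, hσ]
  · exact fun i => ⟨fun h => hκ.monotone ((hp i).1 h), fun h => hκ.monotone ((hp i).2 h)⟩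

theorem prism_facet_map {m' : ℕ} {K : Complex m V} {L : Complex m' V'} {s : V → V'}
    (hs : ∀ f ∈ K.facets, L.IsSimplex (s ∘ f.2)) :
    ∀ f ∈ K.prism.facets, L.prism.IsSimplex (Prod.map s id ∘ f.2) := fun f hf =>
  IsSimplex.prism_map hs (σ := f.2) ⟨f, hf, id, strictMono_id, fun _ => rfl⟩

theorem IsSimplex.prism_vertical {K : Complex m V} {v : V} (h : K.IsSimplex ![v]) :
    K.prism.IsSimplex ![(v, false), (v, true)] := by
  obtain ⟨f, hf, ι, -, h⟩ := h
  refine isSimplex_prism_iff.2 ⟨f, hf, ι 0, fun _ => ι 0, ?_, ?_, ?_, ?_⟩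
  · intro i j hij
    fin_cases i <;> fin_cases j <;> simp_all
  · intro i
    rw [← h 0]
    fin_cases i <;> rfl
  · intro i j hij
    fin_cases i <;> fin_cases j <;> simp_all
  · simp

theorem IsSimplex.prism_horizontal {K : Complex m V} {v w : V} (h : K.IsSimplex ![v, w])
    (b : Bool) : K.prism.IsSimplex ![(v, b), (w, b)] := by
  obtain ⟨f, hf, i, j, hij, rfl, rfl⟩ := isSimplex_pair_iff.1 h
  -- An edge in the unprimed copy needs the crossing at or after its last vertex, one in the primed
  -- copy at or before its first.
  refine isSimplex_prism_iff.2 ⟨f, hf, bif b then i else j, ![i, j], ?_, ?_, ?_, ?_⟩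
  · intro k l hkl
    fin_cases k <;> fin_cases l <;> simp_all
  · intro k
    fin_cases k <;> rfl
  · intro k l hkl
    fin_cases k <;> fin_cases l <;> simp_all
  · intro k
    cases b <;> fin_cases k <;> simp [hij.le]

theorem IsSimplex.prism_level {K : Complex m V} {u v w : V} (h : K.IsSimplex ![u, v, w])
    (b : Bool) : K.prism.IsSimplex ![(u, b), (v, b), (w, b)] := by
  obtain ⟨f, hf, ι, hι, h⟩ := h
  refine isSimplex_prism_iff.2 ⟨f, hf, bif b then ι 0 else ι 2, ι, ?_, ?_, ?_, ?_⟩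
  · exact fun k l hkl => Or.inl (hι hkl)
  · intro k
    rw [← h]
    fin_cases k <;> rfl
  · intro k l hkl
    fin_cases k <;> fin_cases l <;> simp_all
  · intro k
    have h0 : ι 0 ≤ ι k := hι.monotone (Fin.zero_le _)
    have h2 : ι k ≤ ι 2 := hι.monotone (Fin.le_last _)
    cases b <;> fin_cases k <;> simp_all

theorem IsSimplex.prism_point {K : Complex m V} {v : V} (h : K.IsSimplex ![v]) (b : Bool) :
    K.prism.IsSimplex ![(v, b)] := by
  have h' := h.prism_vertical.comp (κ := ![if b then 1 else 0]) (by
    intro i j hij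
    omega)
  convert h' using 1
  funext i
  fin_cases i
  cases b <;> rfl

/-- Closing up the circle changes only the identifications, which `IsSimplex` does not see. -/
theorem IsSimplex.circle [DecidableEq V] {K : Complex m V} {k : ℕ} {σ : Fin k → V × Bool}
    (h : K.prism.IsSimplex σ) : K.circle.IsSimplex σ := h

/-- With `prism_upper`, one of the two triangles of the square over an edge. They share the
diagonal, so flatness on both makes the square commute. -/
theorem IsSimplex.prism_lower {K : Complex m V} {v w : V} (h : K.IsSimplex ![v, w]) :
    K.prism.IsSimplex ![(v, false), (w, false), (w, true)] := by
  obtain ⟨f, hf, i, j, hij, rfl, rfl⟩ := isSimplex_pair_iff.1 h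
  refine isSimplex_prism_iff.2 ⟨f, hf, j, ![i, j, j], ?_, ?_, ?_, ?_⟩
  · intro k l hkl
    fin_cases k <;> fin_cases l <;> simp_all
  · intro k
    fin_cases k <;> rfl
  · intro k l hkl
    fin_cases k <;> fin_cases l <;> simp_all
  · intro k
    fin_cases k <;> simp [hij.le]

theorem IsSimplex.prism_upper {K : Complex m V} {v w : V} (h : K.IsSimplex ![v, w]) :
    K.prism.IsSimplex ![(v, false), (v, true), (w, true)] := by
  obtain ⟨f, hf, i, j, hij, rfl, rfl⟩ := isSimplex_pair_iff.1 h
  refine isSimplex_prism_iff.2 ⟨f, hf, i, ![i, i, j], ?_, ?_, ?_, ?_⟩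
  · intro k l hkl
    fin_cases k <;> fin_cases l <;> simp_all
  · intro k
    fin_cases k <;> rfl
  · intro k l hkl
    fin_cases k <;> fin_cases l <;> simp_all
  · intro k
    fin_cases k <;> simp [hij.le]

end Complex

/-! ## Interior vertices of the cobordisms -/

namespace Complex

variable {m : ℕ} {V : Type} [DecidableEq V]

/-- Each vertex is excluded by exhibiting a boundary face through it. On a concrete finite complex
the hypothesis is decidable, so it can be settled by evaluation. -/
theorem numInterior_eq_zero {K : Complex (m + 1) V}
    (h : ∀ v, ¬ K.IsSimplex ![v] ∨ ∃ τ ∈ K.faces,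
      K.faces.countP (fun σ => decide (K.Ident τ σ)) = 1 ∧ ∃ i, K.Ident ![τ i] ![v]) :
    K.numInterior = 0 := by
  have : {v | K.IsInteriorVertex v} = ∅ := by
    ext v
    simp only [Set.mem_ofPred_eq, Set.mem_empty_iff_false, iff_false]
    rintro ⟨hv, hv'⟩
    rcases h v with h | ⟨τ, hτ, h1, i, hi⟩
    · exact h hv
    · exact hv' τ hτ h1 i hi
  rw [numInterior, this, Set.image_empty, Set.ncard_empty]

/-- Besides `v₀`, its glued copy must be exempted from the exclusion, since both represent one
vertex of the quotient. -/
theorem numInterior_eq_one {K : Complex (m + 1) V} (v₀ : V) (h₀ : K.IsInteriorVertex v₀)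
    (h : ∀ v, v = v₀ ∨ K.glue v₀ v = true ∨ ¬ K.IsSimplex ![v] ∨ ∃ τ ∈ K.faces,
      K.faces.countP (fun σ => decide (K.Ident τ σ)) = 1 ∧ ∃ i, K.Ident ![τ i] ![v]) :
    K.numInterior = 1 := by
  have : Quot.mk (fun v w => K.glue v w = true) '' {v | K.IsInteriorVertex v} =
      {Quot.mk _ v₀} := by
    ext q
    simp only [Set.mem_image, Set.mem_ofPred_eq, Set.mem_singleton_iff]
    constructor
    · rintro ⟨v, ⟨hv, hv'⟩, rfl⟩
      rcases h v with rfl | h | h | ⟨τ, hτ, h1, i, hi⟩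
      · rfl
      · exact (Quot.sound h :
          Quot.mk (fun v w => K.glue v w = true) v₀ = Quot.mk _ v).symm
      · exact absurd hv h
      · exact absurd hi (hv' τ hτ h1 i)
    · rintro rfl
      exact ⟨v₀, h₀, rfl⟩
  rw [numInterior, this, Set.ncard_singleton]

theorem isSimplex_singleton_iff {V : Type} {K : Complex m V} {v : V} :
    K.IsSimplex ![v] ↔ ∃ f ∈ K.facets, ∃ i, f.2 i = v := by
  constructor
  · rintro ⟨f, hf, ι, -, h⟩
    exact ⟨f, hf, ι 0, (h 0).symm⟩
  · rintro ⟨f, hf, i, rfl⟩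
    refine ⟨f, hf, fun _ => i, ?_, fun j => by fin_cases j; rfl⟩
    intro a b hab
    omega

instance {K : Complex m V} {v : V} : Decidable (K.IsSimplex ![v]) :=
  decidable_of_iff' _ isSimplex_singleton_iff

instance {K : Complex (m + 1) V} {τ : Fin m → V} : Decidable (K.IsBoundaryFace τ) :=
  inferInstanceAs (Decidable (_ = 1))

instance {K : Complex (m + 1) V} {v : V} : Decidable (K.IsInteriorVertex v) := by
  unfold IsInteriorVertex
  infer_instance

end Complex

/-! ### Normalisation exponents of the projector and of the change of triangulation. -/

section Exponents

open GappedTube.Complex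

set_option maxRecDepth 100000

/-- Every vertex lies on a physical boundary component, so the bulk terms vanish. On each component
only the middle vertex of the source and that of the target are interior, each counting one half. -/
theorem exponent_projector2 :
    twiceExponent projector2.bulk doubleTube2 doubleTube2 = 0 ∧
    ∀ b, twiceExponent (projector2.bulk.side b) (doubleTube2.side b) (doubleTube2.side b) = 2 := by
  have h1 : projector2.bulk.numInterior = 0 := numInterior_eq_zero (by decide +kernel)
  have h2 : doubleTube2.numInterior = 0 := numInterior_eq_zero (by decide +kernel)
  have h3 : ∀ b, (projector2.bulk.side b).numInterior = 0 :=
    Bool.forall_bool.2 ⟨numInterior_eq_zero (by decide +kernel),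
      numInterior_eq_zero (by decide +kernel)⟩
  have h4 : ∀ b, (doubleTube2.side b).numInterior = 1 :=
    Bool.forall_bool.2 ⟨numInterior_eq_one (1, false) (by decide +kernel) (by decide +kernel),
      numInterior_eq_one (1, true) (by decide +kernel) (by decide +kernel)⟩
  simp only [twiceExponent, h1, h2, h3, h4]
  simp

/-- Here only the source has a middle vertex, whence exponent one half on each component. -/
theorem exponent_fusion2 :
    twiceExponent fusion2.bulk doubleTube2 tube2 = 0 ∧
    ∀ b, twiceExponent (fusion2.bulk.side b) (doubleTube2.side b) (tube2.side b) = 1 := by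
  have h1 : fusion2.bulk.numInterior = 0 := numInterior_eq_zero (by decide +kernel)
  have h2 : doubleTube2.numInterior = 0 := numInterior_eq_zero (by decide +kernel)
  have h2' : tube2.numInterior = 0 := numInterior_eq_zero (by decide +kernel)
  have h3 : ∀ b, (fusion2.bulk.side b).numInterior = 0 :=
    Bool.forall_bool.2 ⟨numInterior_eq_zero (by decide +kernel),
      numInterior_eq_zero (by decide +kernel)⟩
  have h3' : ∀ b, (tube2.side b).numInterior = 0 :=
    Bool.forall_bool.2 ⟨numInterior_eq_zero (by decide +kernel),
      numInterior_eq_zero (by decide +kernel)⟩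
  have h4 : ∀ b, (doubleTube2.side b).numInterior = 1 :=
    Bool.forall_bool.2 ⟨numInterior_eq_one (1, false) (by decide +kernel) (by decide +kernel),
      numInterior_eq_one (1, true) (by decide +kernel) (by decide +kernel)⟩
  simp only [twiceExponent, h1, h2, h2', h3, h3', h4]
  simp

/-- The count is that of `exponent_projector2`: the two copies of the middle vertex at the ends of
the circle are identified and count once. -/
theorem exponent_projector3 :
    twiceExponent projector3.bulk doubleTube3 doubleTube3 = 0 ∧
    ∀ b, twiceExponent (projector3.bulk.side b) (doubleTube3.side b) (doubleTube3.side b) = 2 := by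
  have h1 : projector3.bulk.numInterior = 0 := numInterior_eq_zero (by decide +kernel)
  have h2 : doubleTube3.numInterior = 0 := numInterior_eq_zero (by decide +kernel)
  have h3 : ∀ b, (projector3.bulk.side b).numInterior = 0 :=
    Bool.forall_bool.2 ⟨numInterior_eq_zero (by decide +kernel),
      numInterior_eq_zero (by decide +kernel)⟩
  have h4 : ∀ b, (doubleTube3.side b).numInterior = 1 :=
    Bool.forall_bool.2
      ⟨numInterior_eq_one ((1, false), false) (by decide +kernel) (by decide +kernel),
        numInterior_eq_one ((1, false), true) (by decide +kernel) (by decide +kernel)⟩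
  simp only [twiceExponent, h1, h2, h3, h4]
  simp

theorem exponent_fusion3 :
    twiceExponent fusion3.bulk doubleTube3 tube3 = 0 ∧
    ∀ b, twiceExponent (fusion3.bulk.side b) (doubleTube3.side b) (tube3.side b) = 1 := by
  have h1 : fusion3.bulk.numInterior = 0 := numInterior_eq_zero (by decide +kernel)
  have h2 : doubleTube3.numInterior = 0 := numInterior_eq_zero (by decide +kernel)
  have h2' : tube3.numInterior = 0 := numInterior_eq_zero (by decide +kernel)
  have h3 : ∀ b, (fusion3.bulk.side b).numInterior = 0 :=
    Bool.forall_bool.2 ⟨numInterior_eq_zero (by decide +kernel),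
      numInterior_eq_zero (by decide +kernel)⟩
  have h3' : ∀ b, (tube3.side b).numInterior = 0 :=
    Bool.forall_bool.2 ⟨numInterior_eq_zero (by decide +kernel),
      numInterior_eq_zero (by decide +kernel)⟩
  have h4 : ∀ b, (doubleTube3.side b).numInterior = 1 :=
    Bool.forall_bool.2
      ⟨numInterior_eq_one ((1, false), false) (by decide +kernel) (by decide +kernel),
        numInterior_eq_one ((1, false), true) (by decide +kernel) (by decide +kernel)⟩
  simp only [twiceExponent, h1, h2, h2', h3, h3', h4]
  simp

end Exponents

/-! ## Colourings given by potentials -/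

section Potentials

variable {G : Type*} [Group G] {A B : Subgroup G} {m : ℕ} {W W' : Type}

/-- By flatness a label on `(i, j+1)` is the product of those on `(i, j)` and `(j, j+1)`, so labels
on consecutive vertices of facets suffice. -/
theorem Colouring.ext_facets {K : Complex (m + 1) (W × Bool)} {c c' : Colouring K A B}
    (h : ∀ f ∈ K.facets, ∀ i : Fin m,
      c.col (f.2 i.castSucc) (f.2 i.succ) = c'.col (f.2 i.castSucc) (f.2 i.succ)) : c = c' := by
  apply Colouring.col_injective
  funext v w
  by_cases hvw : K.IsSimplex ![v, w]
  swap
  · rw [c.off _ _ hvw, c'.off _ _ hvw]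
  obtain ⟨f, hf, i, j, hij, rfl, rfl⟩ := Complex.isSimplex_pair_iff.1 hvw
  clear hvw
  induction j using Fin.induction with
  | zero => exact absurd hij (Fin.not_lt_zero i)
  | succ j ih =>
    rcases (Fin.le_castSucc_iff.2 hij).lt_or_eq with hj | rfl
    · have hs := Complex.isSimplex_triple_facet hf hj j.castSucc_lt_succ
      rw [← c.flat _ _ _ hs, ← c'.flat _ _ _ hs, ih hj, h f hf j]
    · exact h f hf j

/-- A potential for colourings of `K`: a labelling of the vertices whose differences form a
colouring. -/
structure IsPotential (K : Complex m (W × Bool)) (A B : Subgroup G) (p : W × Bool → G) :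
    Prop where
  glue : ∀ v w v' w', K.glue v v' = true → K.glue w w' = true →
    (p v)⁻¹ * p w = (p v')⁻¹ * p w'
  mem_A : ∀ v w, v.2 = false → w.2 = false → (p v)⁻¹ * p w ∈ A
  mem_B : ∀ v w, v.2 = true → w.2 = true → (p v)⁻¹ * p w ∈ B

open Classical in
/-- The colouring whose values on the edges are the differences of a potential. -/
noncomputable def Colouring.ofPotential {K : Complex m (W × Bool)} {p : W × Bool → G}
    (hp : IsPotential K A B p) : Colouring K A B where
  col v w := if K.IsSimplex ![v, w] then (p v)⁻¹ * p w else 1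
  flat u v w h := by
    obtain ⟨h₁, h₂, h₃⟩ := h.pair_of_triple
    rw [if_pos h₁, if_pos h₂, if_pos h₃]
    group
  glued v w v' w' h h' hI := by
    rw [if_pos h, if_pos h']
    rcases hI with hI | hI | hI
    · have h0 : v = v' := congrFun hI 0
      have h1 : w = w' := congrFun hI 1
      rw [h0, h1]
    · exact hp.glue _ _ _ _ (hI 0) (hI 1)
    · exact (hp.glue _ _ _ _ (hI 0) (hI 1)).symm
  mem_A v w h hv hw := by
    rw [if_pos h]
    exact hp.mem_A v w hv hw
  mem_B v w h hv hw := by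
    rw [if_pos h]
    exact hp.mem_B v w hv hw
  off v w h := if_neg h

theorem Colouring.ofPotential_col {K : Complex m (W × Bool)} {p : W × Bool → G}
    (hp : IsPotential K A B p) {v w : W × Bool} (h : K.IsSimplex ![v, w]) :
    (ofPotential hp).col v w = (p v)⁻¹ * p w :=
  if_pos h

theorem Colouring.ofPotential_congr {K : Complex m (W × Bool)} {p p' : W × Bool → G}
    (hp : IsPotential K A B p) (hp' : IsPotential K A B p')
    (h : ∀ v w, (p v)⁻¹ * p w = (p' v)⁻¹ * p' w) : ofPotential hp = ofPotential hp' := by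
  apply Colouring.col_injective
  funext v w
  simp only [ofPotential, h]

/-- Restricting a colouring by differences amounts to pulling back its potential, so exactly one
colouring `c` qualifies. -/
theorem Colouring.ofPotential_restrictsTo_iff {m' : ℕ} {L : Complex m' (W' × Bool)}
    {K : Complex m (W × Bool)} {s : W → W'} {p : W' × Bool → G} (hp : IsPotential L A B p)
    {q : W × Bool → G} (hq : IsPotential K A B q) (hpq : ∀ v, p (Prod.map s id v) = q v)
    (hs : ∀ f ∈ K.facets, L.IsSimplex (Prod.map s id ∘ f.2)) (c : Colouring K A B) :
    (ofPotential hp).RestrictsTo s c ↔ ofPotential hq = c := by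
  have hs' : ∀ {v w}, K.IsSimplex ![v, w] →
      L.IsSimplex ![Prod.map s id v, Prod.map s id w] := by
    intro v w h
    obtain ⟨f, hf, i, j, hij, rfl, rfl⟩ := Complex.isSimplex_pair_iff.1 h
    convert (hs f hf).comp (Complex.strictMono_pair hij) using 1
    ext k : 1
    fin_cases k <;> rfl
  have key : ∀ {v w}, K.IsSimplex ![v, w] →
      (ofPotential hp).col (Prod.map s id v) (Prod.map s id w) = (ofPotential hq).col v w := by
    intro v w h
    rw [ofPotential_col hp (hs' h), ofPotential_col hq h, hpq, hpq]
  constructor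
  · intro h
    apply Colouring.col_injective
    funext v w
    by_cases hvw : K.IsSimplex ![v, w]
    · rw [← key hvw]
      exact h v w hvw
    · rw [Colouring.off _ _ _ hvw, Colouring.off _ _ _ hvw]
  · rintro rfl v w h
    exact key h

/-- The differences of a potential along a simplex. -/
def differences (p : W × Bool → G) {n : ℕ} (σ : Fin (n + 1) → W × Bool) : Fin n → G :=
  fun i => (p (σ i.castSucc))⁻¹ * p (σ i.succ)

theorem Colouring.ofPotential_on {K : Complex m (W × Bool)} {p : W × Bool → G}
    (hp : IsPotential K A B p) {n : ℕ} {σ : Fin (n + 1) → W × Bool} (h : K.IsSimplex σ) :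
    (ofPotential hp).on σ = differences p σ := by
  funext i
  refine ofPotential_col hp ?_
  convert h.comp (Complex.strictMono_pair i.castSucc_lt_succ) using 1
  ext k : 1
  fin_cases k <;> rfl

theorem Complex.isSimplex_of_mem_side {K : Complex (m + 1) (W × Bool)} {b : Bool}
    {f : ℤˣ × (Fin m → W × Bool)} (hf : f ∈ (K.side b).facets) : K.IsSimplex f.2 := by
  simp only [Complex.side, List.mem_flatMap, List.mem_filterMap] at hf
  obtain ⟨F, hF, i, -, hi⟩ := hf
  split_ifs at hi with h
  cases hi
  exact Complex.isSimplex_facet hF (Fin.strictMono_succAbove i)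

variable {k : ℕ}

/-- The Boltzmann weight of the colouring given by a potential. -/
noncomputable def potentialWeight (K : Complex (k + 3) (W × Bool)) (ω : (Fin (k + 2) → G) → Circle)
    (φ : (Fin (k + 1) → A) → Circle) (ψ : (Fin (k + 1) → B) → Circle) (p : W × Bool → G) :
    Circle :=
  (((K.side false).facets.map fun f => evalOn A φ (differences p f.2) ^ (f.1 : ℤ)).prod *
    ((K.side true).facets.map fun f => evalOn B ψ (differences p f.2) ^ (f.1 : ℤ)).prod) *
    (K.facets.map fun f => ω (differences p f.2) ^ (f.1 : ℤ)).prod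

theorem weight_ofPotential {K : Complex (k + 3) (W × Bool)} (ω : (Fin (k + 2) → G) → Circle)
    (φ : (Fin (k + 1) → A) → Circle) (ψ : (Fin (k + 1) → B) → Circle) {p : W × Bool → G}
    (hp : IsPotential K A B p) :
    weight ω φ ψ (Colouring.ofPotential hp) = potentialWeight K ω φ ψ p := by
  unfold weight potentialWeight
  congr 1
  · congr 1
    · exact congrArg _ (List.map_congr_left fun f hf => by
        rw [Colouring.ofPotential_on hp (Complex.isSimplex_of_mem_side hf)])
    · exact congrArg _ (List.map_congr_left fun f hf => by
        rw [Colouring.ofPotential_on hp (Complex.isSimplex_of_mem_side hf)])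
  · exact congrArg _ (List.map_congr_left fun f hf => by
      rw [Colouring.ofPotential_on hp (σ := f.2) ⟨f, hf, id, strictMono_id, fun _ => rfl⟩])

/-- The weight is multiplicative in signed simplices, so a complex that is the formal difference of
two copies of `L`, in the bulk and on both sides, has a quotient as its weight. It is used for the
projector, where `L` is a triangle times `Y`. -/
theorem potentialWeight_eq_div {K : Complex (k + 3) (W × Bool)}
    {L : Complex (k + 3) (W' × Bool)} (s s' : W' × Bool → W × Bool)
    (h : K.facets = (L.facets.map fun f => (f.1, s ∘ f.2)) ++
      L.facets.map fun f => (-f.1, s' ∘ f.2))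
    (hside : ∀ b, (K.side b).facets = ((L.side b).facets.map fun f => (f.1, s ∘ f.2)) ++
      (L.side b).facets.map fun f => (-f.1, s' ∘ f.2))
    (ω : (Fin (k + 2) → G) → Circle) (φ : (Fin (k + 1) → A) → Circle)
    (ψ : (Fin (k + 1) → B) → Circle) (p : W × Bool → G) :
    potentialWeight K ω φ ψ p =
      potentialWeight L ω φ ψ (p ∘ s) / potentialWeight L ω φ ψ (p ∘ s') := by
  -- One identity serves the bulk and both boundary components: a negated sign inverts a factor.
  have key : ∀ {n : ℕ} (l : List (ℤˣ × (Fin (n + 1) → W' × Bool))) (F : (Fin n → G) → Circle),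
      (((l.map fun f => (f.1, s ∘ f.2)) ++ l.map fun f => (-f.1, s' ∘ f.2)).map
        fun f => F (differences p f.2) ^ (f.1 : ℤ)).prod =
      (l.map fun f => F (differences (p ∘ s) f.2) ^ (f.1 : ℤ)).prod /
        (l.map fun f => F (differences (p ∘ s') f.2) ^ (f.1 : ℤ)).prod := by
    intro n l F
    rw [List.map_append, List.prod_append, List.map_map, List.map_map, div_eq_mul_inv,
      List.prod_inv, List.map_map]
    congr 1
    refine congrArg _ (List.map_congr_left fun f _ => ?_)
    simp only [Function.comp_apply, Units.val_neg, zpow_neg]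
    rfl
  simp only [potentialWeight, h, hside, key]
  rw [div_mul_div_comm, div_mul_div_comm]

end Potentials

/-! ## Chains -/

/-- A complex on the vertices `0 < 1 < … < n` whose simplices are spanned by the
edges `(i, i + 1)`. -/
structure IsChain {m n : ℕ} (K : Complex m (Fin (n + 1))) : Prop where
  glue : ∀ v w, K.glue v w = false
  edge : ∀ i : Fin n, K.IsSimplex ![i.castSucc, i.succ]
  vertex : ∀ i, K.IsSimplex ![i]
  prism_step : ∀ f ∈ K.prism.facets, ∀ i : Fin m,
    (∃ (j : Fin n) (b : Bool), f.2 i.castSucc = (j.castSucc, b) ∧ f.2 i.succ = (j.succ, b)) ∨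
      ∃ j, f.2 i.castSucc = (j, false) ∧ f.2 i.succ = (j, true)
  circle_step : ∀ f ∈ K.circle.prism.facets, ∀ i : Fin (m + 1),
    (∃ (j : Fin n) (b b' : Bool), f.2 i.castSucc = ((j.castSucc, b), b') ∧
        f.2 i.succ = ((j.succ, b), b')) ∨
      (∃ (j : Fin (n + 1)) (b : Bool), f.2 i.castSucc = ((j, false), b) ∧
        f.2 i.succ = ((j, true), b)) ∨
      ∃ (j : Fin (n + 1)) (b : Bool), f.2 i.castSucc = ((j, b), false) ∧
        f.2 i.succ = ((j, b), true)

section Chains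

set_option maxRecDepth 100000

/-- As for the other three building blocks, the step conditions are finite checks on explicit lists
of facets. -/
theorem isChain_interval : IsChain interval where
  glue _ _ := rfl
  edge i := Complex.isSimplex_pair_iff.2 (by revert i; decide +kernel)
  vertex i := by revert i; decide +kernel
  prism_step := by decide +kernel
  circle_step := by decide +kernel

theorem isChain_path : IsChain path where
  glue _ _ := rfl
  edge i := Complex.isSimplex_pair_iff.2 (by revert i; decide +kernel)
  vertex i := by revert i; decide +kernel
  prism_step := by decide +kernel
  circle_step := by decide +kernel

theorem isChain_triangle : IsChain triangle where
  glue _ _ := rfl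
  edge i := Complex.isSimplex_pair_iff.2 (by revert i; decide +kernel)
  vertex i := by revert i; decide +kernel
  prism_step := by decide +kernel
  circle_step := by decide +kernel

theorem isChain_pinched : IsChain pinched where
  glue _ _ := rfl
  edge i := Complex.isSimplex_pair_iff.2 (by revert i; decide +kernel)
  vertex i := by revert i; decide +kernel
  prism_step := by decide +kernel
  circle_step := by decide +kernel

end Chains

/-! ### Colourings of a chain times an interval. -/

section ChainColourings

variable {G : Type*} [Group G] {A B : Subgroup G} {m n : ℕ}

/-- The potential with value `g` on the edge `00'` and given, up to translation by `g`, by elements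
of `A` on the first and elements of `B` on the second component of the boundary. -/
def chainPotential (g : G) (P : Fin n → A × B) (v : Fin n × Bool) : G :=
  bif v.2 then g * (P v.1).2 else (P v.1).1

theorem isPotential_chain {K : Complex m (Fin (n + 1))} (hK : IsChain K) (g : G)
    (P : Fin (n + 1) → A × B) : IsPotential K.prism A B (chainPotential g P) where
  glue v w v' w' h := by simp [Complex.prism, hK.glue] at h
  mem_A v w hv hw := by
    simp only [chainPotential, hv, hw, cond_false]
    exact A.mul_mem (A.inv_mem (SetLike.coe_mem _)) (SetLike.coe_mem _)
  mem_B v w hv hw := by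
    simp only [chainPotential, hv, hw, cond_true, mul_inv_rev]
    rw [mul_assoc, inv_mul_cancel_left]
    exact B.mul_mem (B.inv_mem (SetLike.coe_mem _)) (SetLike.coe_mem _)

/-- The colouring of `K × 𝕀` with label `g` on `00'` and labels `(P i)⁻¹ (P j)` on the physical
boundary edges. -/
noncomputable def chainColouring {K : Complex m (Fin (n + 1))} (hK : IsChain K) (g : G)
    (P : Fin (n + 1) → A × B) : Colouring K.prism A B :=
  Colouring.ofPotential (isPotential_chain hK g P)

/-- The two potentials differ by the constant left factor `k.1`, which differences do not see. This
produces the action of `A × B` on the label `g` of the starting edge. -/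
theorem chainColouring_translate {K : Complex m (Fin (n + 1))} (hK : IsChain K) (g : G)
    (k : A × B) (P : Fin (n + 1) → A × B) :
    chainColouring hK g (fun i => k * P i) =
      chainColouring hK ((k.1 : G)⁻¹ * g * k.2) P := by
  refine Colouring.ofPotential_congr _ _ ?_
  rintro ⟨i, s⟩ ⟨j, t⟩
  cases s <;> cases t <;> simp [chainPotential] <;> group

/-- Fixing `P 0 = 1` removes the translation ambiguity. Then `g` is the label of `00'`, and each
ratio of consecutive `P i` is read off from the physical boundary. -/
theorem chainColouring_injective {K : Complex m (Fin (n + 1))} (hK : IsChain K) :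
    Function.Injective fun q : G × (Fin n → A × B) =>
      chainColouring hK q.1 (Fin.cons 1 q.2) := by
  rintro ⟨g, P⟩ ⟨g', P'⟩ h
  have h0 := congrArg (fun c => c.col (0, false) (0, true)) h
  simp only [chainColouring, Colouring.ofPotential_col _ (hK.vertex 0).prism_vertical,
    chainPotential, cond_false, cond_true, Fin.cons_zero, Prod.fst_one, Prod.snd_one,
    OneMemClass.coe_one, inv_one, mul_one, one_mul] at h0
  subst h0
  have hP : ∀ i, (Fin.cons 1 P : Fin (n + 1) → A × B) i =
      (Fin.cons 1 P' : Fin (n + 1) → A × B) i := by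
    intro i
    induction i using Fin.induction with
    | zero => rfl
    | succ i ih =>
      have h1 := congrArg (fun c => c.col (i.castSucc, false) (i.succ, false)) h
      have h2 := congrArg (fun c => c.col (i.castSucc, true) (i.succ, true)) h
      simp only [chainColouring, Colouring.ofPotential_col _ ((hK.edge i).prism_horizontal _),
        chainPotential, cond_false, cond_true, ih] at h1 h2
      refine Prod.ext (Subtype.ext ?_) (Subtype.ext ?_)
      · simpa using h1
      · simpa using h2
  refine Prod.ext rfl (funext fun i => ?_)
  simpa using hP i.succ

theorem chainColouring_surjective {K : Complex m (Fin (n + 1))} (hK : IsChain K) :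
    Function.Surjective fun q : G × (Fin n → A × B) =>
      chainColouring hK q.1 (Fin.cons 1 q.2) := by
  intro c
  let h : Fin n → A × B := fun i =>
    (⟨c.col (i.castSucc, false) (i.succ, false),
      c.mem_A _ _ ((hK.edge i).prism_horizontal _) rfl rfl⟩,
     ⟨c.col (i.castSucc, true) (i.succ, true),
      c.mem_B _ _ ((hK.edge i).prism_horizontal _) rfl rfl⟩)
  -- The composites of the boundary labels, starting from `1`.
  let P : Fin (n + 1) → A × B := Fin.partialProd h
  let g : G := c.col (0, false) (0, true)
  have hP : (Fin.cons 1 fun i => P i.succ : Fin (n + 1) → A × B) = P := by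
    funext i
    induction i using Fin.cases with
    | zero => exact (Fin.partialProd_zero h).symm
    | succ i => rfl
  have hh : ∀ i : Fin n, P i.succ = P i.castSucc * h i := fun i => Fin.partialProd_succ h i
  -- Commutativity of the square over `(i, i+1)` propagates the label of the `𝕀`-edge from one
  -- vertex to the next.
  have hv : ∀ i, c.col (i, false) (i, true) = ((P i).1 : G)⁻¹ * (g * (P i).2) := by
    intro i
    induction i using Fin.induction with
    | zero => simp [P, g]
    | succ i ih =>
      have e := (c.flat _ _ _ (hK.edge i).prism_lower).trans
        (c.flat _ _ _ (hK.edge i).prism_upper).symm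
      rw [← eq_inv_mul_iff_mul_eq, ih] at e
      rw [e, hh]
      simp only [Prod.fst_mul, Prod.snd_mul, Subgroup.coe_mul, mul_inv_rev, h, mul_assoc]
  refine ⟨(g, fun i => P i.succ), ?_⟩
  simp only [hP]
  refine Colouring.ext_facets fun f hf i => ?_
  have hf' := Complex.isSimplex_pair_facet hf i.castSucc_lt_succ
  rw [chainColouring, Colouring.ofPotential_col _ hf']
  rcases hK.prism_step f hf i with ⟨j, b, h1, h2⟩ | ⟨j, h1, h2⟩
  · rw [h1, h2]
    cases b <;> simp [chainPotential, hh, h]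
  · rw [h1, h2, hv]
    rfl

theorem chainColouring_bijective {K : Complex m (Fin (n + 1))} (hK : IsChain K) :
    Function.Bijective fun q : G × (Fin n → A × B) =>
      chainColouring hK q.1 (Fin.cons 1 q.2) :=
  ⟨chainColouring_injective hK, chainColouring_surjective hK⟩

theorem chainColouring_restrictsTo_iff {m' n' : ℕ} {K : Complex m (Fin (n + 1))}
    (hK : IsChain K) {L : Complex m' (Fin (n' + 1))} (hL : IsChain L)
    {s : Fin (n + 1) → Fin (n' + 1)} (hs : ∀ f ∈ K.facets, L.IsSimplex (s ∘ f.2)) (g : G)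
    (P : Fin (n' + 1) → A × B) (c : Colouring K.prism A B) :
    (chainColouring hL g P).RestrictsTo s c ↔ chainColouring hK g (P ∘ s) = c :=
  Colouring.ofPotential_restrictsTo_iff _ _ (fun _ => rfl) (Complex.prism_facet_map hs) c

end ChainColourings

/-! ## Chains times a circle -/

section LoopChainColourings

variable {G : Type*} [Group G] {A B : Subgroup G} {m n : ℕ}

variable (A B) in
/-- The objects of the relative groupoid `ΛG_{ΛA ΛB}`: an element `g` of `G` and a loop `z ∈ A`
that `g` conjugates into `B`. -/
abbrev LoopObj : Type _ := {x : G × G // x.2 ∈ A ∧ x.1⁻¹ * x.2 * x.1 ∈ B}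

/-- The action of `A × B` on the objects of `ΛG_{ΛA ΛB}`. -/
def LoopObj.act (x : LoopObj A B) (k : A × B) : LoopObj A B :=
  ⟨((k.1 : G)⁻¹ * x.1.1 * k.2, (k.1 : G)⁻¹ * x.1.2 * k.1),
    A.mul_mem (A.mul_mem (A.inv_mem k.1.2) x.2.1) k.1.2, by
      have := B.mul_mem (B.mul_mem (B.inv_mem k.2.2) x.2.2) k.2.2
      convert this using 1
      group⟩

/-- The potential with value `g` on `00'`, with a monodromy `z` around the circle. -/
def loopChainPotential (x : LoopObj A B) (P : Fin n → A × B) (v : (Fin n × Bool) × Bool) : G :=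
  (bif v.1.2 then x.1.2 else 1) * chainPotential x.1.1 P (v.1.1, v.2)

theorem isPotential_loopChain {K : Complex m (Fin (n + 1))} (x : LoopObj A B)
    (P : Fin (n + 1) → A × B) :
    IsPotential K.circle.prism A B (loopChainPotential x P) where
  glue := by
    rintro ⟨⟨i, s⟩, t⟩ ⟨⟨j, s₁⟩, t₁⟩ ⟨⟨i', s'⟩, t'⟩ ⟨⟨j', s₁'⟩, t₁'⟩ h h'
    simp only [Complex.prism, Complex.circle, Bool.and_eq_true, beq_iff_eq] at h h'
    obtain ⟨⟨⟨rfl, rfl⟩, rfl⟩, rfl⟩ := h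
    obtain ⟨⟨⟨rfl, rfl⟩, rfl⟩, rfl⟩ := h'
    -- At identified vertices the potentials differ by the left factor `z`, which cancels in
    -- differences.
    simp only [loopChainPotential, cond_false, cond_true]
    group
  mem_A := by
    rintro ⟨⟨i, s⟩, _⟩ ⟨⟨j, s₁⟩, _⟩ rfl rfl
    refine A.mul_mem (A.inv_mem (A.mul_mem ?_ ?_)) (A.mul_mem ?_ ?_)
    · cases s
      exacts [A.one_mem, x.2.1]
    · exact SetLike.coe_mem _
    · cases s₁
      exacts [A.one_mem, x.2.1]
    · exact SetLike.coe_mem _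
  mem_B := by
    rintro ⟨⟨i, s⟩, _⟩ ⟨⟨j, s₁⟩, _⟩ rfl rfl
    -- On the second component the monodromy is moved past `g`: `z g b = g (g⁻¹ z g) b`, and `g⁻¹ z
    -- g ∈ B`.
    have key : ∀ i s, ∃ b ∈ B, loopChainPotential x P ((i, s), true) = x.1.1 * b := by
      intro i s
      refine ⟨x.1.1⁻¹ * (bif s then x.1.2 else 1) * x.1.1 * (P i).2,
        B.mul_mem ?_ (SetLike.coe_mem _), ?_⟩
      · cases s
        · simp
        · exact x.2.2
      · simp only [loopChainPotential, chainPotential, cond_true]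
        group
    obtain ⟨b, hb, h⟩ := key i s
    obtain ⟨b', hb', h'⟩ := key j s₁
    rw [h, h', mul_inv_rev, mul_assoc, inv_mul_cancel_left]
    exact B.mul_mem (B.inv_mem hb) hb'

/-- The colouring of `K × 𝕊¹ × 𝕀` with label `g` on `00'`, label `z` on `00̃` and labels
`(P i)⁻¹ (P j)` on the physical boundary edges over the edges of `K`. -/
noncomputable def loopChainColouring (K : Complex m (Fin (n + 1))) (x : LoopObj A B)
    (P : Fin (n + 1) → A × B) : Colouring K.circle.prism A B :=
  Colouring.ofPotential (isPotential_loopChain x P)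

theorem loopChainColouring_translate (K : Complex m (Fin (n + 1))) (x : LoopObj A B)
    (k : A × B) (P : Fin (n + 1) → A × B) :
    loopChainColouring K x (fun i => k * P i) = loopChainColouring K (x.act k) P := by
  refine Colouring.ofPotential_congr _ _ ?_
  have key : ∀ v, loopChainPotential x (fun i => k * P i) v =
      k.1 * loopChainPotential (x.act k) P v := by
    rintro ⟨⟨i, s⟩, t⟩
    cases s <;> cases t <;> simp [loopChainPotential, chainPotential, LoopObj.act] <;> group
  intro v w
  rw [key, key]
  group

theorem loopChainColouring_injective {K : Complex m (Fin (n + 1))} (hK : IsChain K) :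
    Function.Injective fun q : LoopObj A B × (Fin n → A × B) =>
      loopChainColouring K q.1 (Fin.cons 1 q.2) := by
  rintro ⟨x, P⟩ ⟨x', P'⟩ h
  have h0 := congrArg (fun c => c.col ((0, false), false) ((0, false), true)) h
  have h1 := congrArg (fun c => c.col ((0, false), false) ((0, true), false)) h
  simp only [loopChainColouring, Colouring.ofPotential_col _
      ((hK.vertex 0).prism_point false).circle.prism_vertical,
    Colouring.ofPotential_col _ ((hK.vertex 0).prism_vertical.circle.prism_horizontal false),
    loopChainPotential, chainPotential, cond_false, cond_true, Fin.cons_zero, Prod.fst_one,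
    Prod.snd_one, OneMemClass.coe_one, inv_one, mul_one, one_mul] at h0 h1
  have hx : x = x' := Subtype.ext (Prod.ext h0 h1)
  subst hx
  have hP : ∀ i, (Fin.cons 1 P : Fin (n + 1) → A × B) i =
      (Fin.cons 1 P' : Fin (n + 1) → A × B) i := by
    intro i
    induction i using Fin.induction with
    | zero => rfl
    | succ i ih =>
      have h1 := congrArg
        (fun c => c.col ((i.castSucc, false), false) ((i.succ, false), false)) h
      have h2 := congrArg (fun c => c.col ((i.castSucc, false), true) ((i.succ, false), true)) h
      simp only [loopChainColouring, Colouring.ofPotential_col _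
        (((hK.edge i).prism_horizontal false).circle.prism_horizontal _),
        loopChainPotential, chainPotential, cond_false, cond_true, ih] at h1 h2
      refine Prod.ext (Subtype.ext ?_) (Subtype.ext ?_)
      · simpa using h1
      · simpa using h2
  refine Prod.ext rfl (funext fun i => ?_)
  simpa using hP i.succ

/-- The identification of the circle's ends fixes the labels on the far copy. Squares along the
chain then conjugate the monodromy, so that it is determined by its value over vertex `0`. -/
theorem loopChainColouring_surjective {K : Complex m (Fin (n + 1))} (hK : IsChain K) :
    Function.Surjective fun q : LoopObj A B × (Fin n → A × B) =>
      loopChainColouring K q.1 (Fin.cons 1 q.2) := by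
  intro c
  have hb : ∀ (i : Fin n) (t : Bool), K.circle.prism.IsSimplex
      ![((i.castSucc, false), t), ((i.succ, false), t)] := fun i t =>
    ((hK.edge i).prism_horizontal false).circle.prism_horizontal t
  have hb' : ∀ (i : Fin n) (t : Bool), K.circle.prism.IsSimplex
      ![((i.castSucc, true), t), ((i.succ, true), t)] := fun i t =>
    ((hK.edge i).prism_horizontal true).circle.prism_horizontal t
  let h : Fin n → A × B := fun i =>
    (⟨c.col ((i.castSucc, false), false) ((i.succ, false), false),
      c.mem_A _ _ (hb i false) rfl rfl⟩,
     ⟨c.col ((i.castSucc, false), true) ((i.succ, false), true),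
      c.mem_B _ _ (hb i true) rfl rfl⟩)
  let P : Fin (n + 1) → A × B := Fin.partialProd h
  let g : G := c.col ((0, false), false) ((0, false), true)
  let z : G := c.col ((0, false), false) ((0, true), false)
  have hI : ∀ (i : Fin (n + 1)) (s : Bool), K.circle.prism.IsSimplex
      ![((i, s), false), ((i, s), true)] := fun i s =>
    ((hK.vertex i).prism_point s).circle.prism_vertical
  have hS : ∀ (i : Fin (n + 1)) (t : Bool), K.circle.prism.IsSimplex
      ![((i, false), t), ((i, true), t)] := fun i t =>
    (hK.vertex i).prism_vertical.circle.prism_horizontal t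
  have hgI : ∀ i, c.col ((i, true), false) ((i, true), true) =
      c.col ((i, false), false) ((i, false), true) := fun i =>
    (c.glued _ _ _ _ (hI i false) (hI i true) (Or.inr (Or.inl fun j => by
      fin_cases j <;> simp [Complex.prism, Complex.circle]))).symm
  have hgb : ∀ i t, c.col ((Fin.castSucc i, true), t) ((i.succ, true), t) =
      c.col ((Fin.castSucc i, false), t) ((i.succ, false), t) := fun i t =>
    (c.glued _ _ _ _ (hb i t) (hb' i t) (Or.inr (Or.inl fun j => by
      fin_cases j <;> simp [Complex.prism, Complex.circle]))).symm
  -- The cylinder over vertex `0` is a square whose two `𝕀`-edges are identified and carry `g`;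
  -- hence the monodromy at the other end is `g⁻¹zg`, and it lies in `B`.
  have hzg : c.col ((0, false), true) ((0, true), true) = g⁻¹ * z * g := by
    have e := (c.flat _ _ _ (hK.vertex 0).prism_vertical.circle.prism_lower).trans
      (c.flat _ _ _ (hK.vertex 0).prism_vertical.circle.prism_upper).symm
    rw [hgI] at e
    rw [mul_assoc, eq_inv_mul_iff_mul_eq]
    exact e.symm
  let x : LoopObj A B := ⟨(g, z), c.mem_A _ _ (hS 0 false) rfl rfl, by
    rw [← hzg]
    exact c.mem_B _ _ (hS 0 true) rfl rfl⟩
  have hP : (Fin.cons 1 fun i => P i.succ : Fin (n + 1) → A × B) = P := by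
    funext i
    induction i using Fin.cases with
    | zero => exact (Fin.partialProd_zero h).symm
    | succ i => rfl
  have hP0 : P 0 = 1 := Fin.partialProd_zero h
  have hh : ∀ i : Fin n, P i.succ = P i.castSucc * h i := fun i => Fin.partialProd_succ h i
  have hvI : ∀ i, c.col ((i, false), false) ((i, false), true) =
      ((P i).1 : G)⁻¹ * (g * (P i).2) := by
    intro i
    induction i using Fin.induction with
    | zero => simp [hP0, g]
    | succ i ih =>
      have e := (c.flat _ _ _ ((hK.edge i).prism_horizontal false).circle.prism_lower).trans
        (c.flat _ _ _ ((hK.edge i).prism_horizontal false).circle.prism_upper).symm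
      rw [← eq_inv_mul_iff_mul_eq, ih] at e
      rw [e, hh]
      simp only [Prod.fst_mul, Prod.snd_mul, Subgroup.coe_mul, mul_inv_rev, h, mul_assoc]
  -- The square `(i, i+1) × 𝕊¹` has equal labels on its two chain edges, so the circle labels at its
  -- ends are conjugate.
  have hsq : ∀ (i : Fin n) t, c.col ((i.succ, false), t) ((i.succ, true), t) =
      (c.col ((i.castSucc, false), t) ((i.succ, false), t))⁻¹ *
        (c.col ((i.castSucc, false), t) ((i.castSucc, true), t) *
        c.col ((i.castSucc, false), t) ((i.succ, false), t)) := by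
    intro i t
    have e := (c.flat _ _ _ ((hK.edge i).prism_lower.circle.prism_level t)).trans
      (c.flat _ _ _ ((hK.edge i).prism_upper.circle.prism_level t)).symm
    rw [hgb] at e
    rw [eq_inv_mul_iff_mul_eq]
    exact e
  have hvS : ∀ i t, c.col ((i, false), t) ((i, true), t) =
      (chainPotential g P (i, t))⁻¹ * (z * chainPotential g P (i, t)) := by
    intro i t
    induction i using Fin.induction with
    | zero => cases t <;> simp [hP0, chainPotential, hzg, z, mul_assoc]
    | succ i ih =>
      rw [hsq, ih]
      cases t <;> simp [chainPotential, hh, h, mul_assoc]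
  refine ⟨(x, fun i => P i.succ), ?_⟩
  simp only [hP]
  refine Colouring.ext_facets fun f hf i => ?_
  have hf' := Complex.isSimplex_pair_facet hf i.castSucc_lt_succ
  rw [loopChainColouring, Colouring.ofPotential_col _ hf']
  rcases hK.circle_step f hf i with ⟨j, b, t, h1, h2⟩ | ⟨j, t, h1, h2⟩ | ⟨j, b, h1, h2⟩
  · rw [h1, h2]
    have : c.col ((j.castSucc, b), t) ((j.succ, b), t) =
        c.col ((j.castSucc, false), t) ((j.succ, false), t) := by
      cases b
      exacts [rfl, hgb j t]
    rw [this]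
    cases t <;> simp [loopChainPotential, chainPotential, hh, h, mul_assoc]
  · rw [h1, h2, hvS]
    simp [loopChainPotential, x]
  · rw [h1, h2]
    have : c.col ((j, b), false) ((j, b), true) = c.col ((j, false), false) ((j, false), true) := by
      cases b
      exacts [rfl, hgI j]
    rw [this, hvI]
    simp [loopChainPotential, chainPotential, x, mul_assoc]

theorem loopChainColouring_bijective {K : Complex m (Fin (n + 1))} (hK : IsChain K) :
    Function.Bijective fun q : LoopObj A B × (Fin n → A × B) =>
      loopChainColouring K q.1 (Fin.cons 1 q.2) :=
  ⟨loopChainColouring_injective hK, loopChainColouring_surjective hK⟩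

theorem loopChainColouring_restrictsTo_iff {m' n' : ℕ} {K : Complex m (Fin (n + 1))}
    {L : Complex m' (Fin (n' + 1))} {s : Fin (n + 1) → Fin (n' + 1)}
    (hs : ∀ f ∈ K.facets, L.IsSimplex (s ∘ f.2)) (x : LoopObj A B)
    (P : Fin (n' + 1) → A × B) (c : Colouring K.circle.prism A B) :
    (loopChainColouring L x P).RestrictsTo (Prod.map s id) c ↔
      loopChainColouring K x (P ∘ s) = c :=
  Colouring.ofPotential_restrictsTo_iff _ _ (fun _ => rfl)
    (Complex.prism_facet_map (K := K.circle) (L := L.circle) (Complex.prism_facet_map hs)) c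

end LoopChainColourings

/-! ## Low-dimensional coboundaries -/

section Coboundaries

variable {G : Type*} [Group G]

theorem coboundary_two (f : (Fin 2 → G) → Circle) (a b c : G) :
    coboundary f ![a, b, c] = f ![b, c] * (f ![a * b, c])⁻¹ * f ![a, b * c] * (f ![a, b])⁻¹ := by
  have h : ∀ j : Fin 3, Fin.contractNth j (· * ·) ![a, b, c] =
      (![![a * b, c], ![a, b * c], ![a, b]] : Fin 3 → Fin 2 → G) j := by
    intro j
    funext i
    fin_cases j <;> fin_cases i <;> rfl
  have h0 : (fun i : Fin 2 => ![a, b, c] i.succ) = ![b, c] := rfl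
  rw [coboundary, Fin.prod_univ_three, h, h, h, h0]
  simp [mul_assoc]

theorem coboundary_three (f : (Fin 3 → G) → Circle) (a b c d : G) :
    coboundary f ![a, b, c, d] = f ![b, c, d] * (f ![a * b, c, d])⁻¹ * f ![a, b * c, d] *
      (f ![a, b, c * d])⁻¹ * f ![a, b, c] := by
  have h : ∀ j : Fin 4, Fin.contractNth j (· * ·) ![a, b, c, d] =
      (![![a * b, c, d], ![a, b * c, d], ![a, b, c * d], ![a, b, c]] :
        Fin 4 → Fin 3 → G) j := by
    intro j
    funext i
    fin_cases j <;> fin_cases i <;> rfl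
  have h0 : (fun i : Fin 3 => ![a, b, c, d] i.succ) = ![b, c, d] := rfl
  rw [coboundary, Fin.prod_univ_four, h, h, h, h, h0]
  simp [mul_assoc, pow_succ]

theorem coboundary_four (f : (Fin 4 → G) → Circle) (a b c d e : G) :
    coboundary f ![a, b, c, d, e] = f ![b, c, d, e] * (f ![a * b, c, d, e])⁻¹ *
      f ![a, b * c, d, e] * (f ![a, b, c * d, e])⁻¹ * f ![a, b, c, d * e] *
      (f ![a, b, c, d])⁻¹ := by
  have h : ∀ j : Fin 5, Fin.contractNth j (· * ·) ![a, b, c, d, e] =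
      (![![a * b, c, d, e], ![a, b * c, d, e], ![a, b, c * d, e], ![a, b, c, d * e],
        ![a, b, c, d]] : Fin 5 → Fin 4 → G) j := by
    intro j
    funext i
    fin_cases j <;> fin_cases i <;> rfl
  have h0 : (fun i : Fin 4 => ![a, b, c, d, e] i.succ) = ![b, c, d, e] := rfl
  rw [coboundary, Fin.prod_univ_five, h, h, h, h, h, h0]
  simp [mul_assoc, pow_succ]

end Coboundaries

/-! ## Transgression of cocycles -/

section Transgression

variable {G : Type*} [Group G]

/-- Naming the successive conjugates by relations `xᵢ yᵢ₊₁ = yᵢ₊₁ xᵢ₊₁` lets coboundary terms be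
matched by rewriting with these relations. -/
theorem transgress3_eq (f : (Fin 3 → G) → Circle) {x₀ x₁ x₂ y₁ y₂ : G}
    (h₁ : x₀ * y₁ = y₁ * x₁) (h₂ : x₁ * y₂ = y₂ * x₂) :
    transgress3 f x₀ y₁ y₂ = f ![x₀, y₁, y₂] * f ![y₁, y₂, x₂] / f ![y₁, x₁, y₂] := by
  have e₁ : y₁⁻¹ * x₀ * y₁ = x₁ := by rw [mul_assoc, h₁, inv_mul_cancel_left]
  have e₂ : (y₁ * y₂)⁻¹ * x₀ * (y₁ * y₂) = x₂ := by
    rw [mul_assoc, ← mul_assoc x₀, h₁, mul_assoc, h₂, ← mul_assoc y₁, inv_mul_cancel_left]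
  rw [transgress3, e₁, e₂]

theorem transgress4_eq (f : (Fin 4 → G) → Circle) {x₀ x₁ x₂ x₃ y₁ y₂ y₃ : G}
    (h₁ : x₀ * y₁ = y₁ * x₁) (h₂ : x₁ * y₂ = y₂ * x₂) (h₃ : x₂ * y₃ = y₃ * x₃) :
    transgress4 f x₀ y₁ y₂ y₃ = f ![y₁, x₁, y₂, y₃] * f ![y₁, y₂, y₃, x₃] /
      (f ![x₀, y₁, y₂, y₃] * f ![y₁, y₂, x₂, y₃]) := by
  have e₁ : y₁⁻¹ * x₀ * y₁ = x₁ := by rw [mul_assoc, h₁, inv_mul_cancel_left]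
  have e₂ : (y₁ * y₂)⁻¹ * x₀ * (y₁ * y₂) = x₂ := by
    rw [mul_assoc, ← mul_assoc x₀, h₁, mul_assoc, h₂, ← mul_assoc y₁, inv_mul_cancel_left]
  have e₃ : (y₁ * y₂ * y₃)⁻¹ * x₀ * (y₁ * y₂ * y₃) = x₃ := by
    rw [mul_inv_rev, mul_assoc, mul_assoc, ← mul_assoc x₀, ← mul_assoc (y₁ * y₂)⁻¹,
      ← mul_assoc (y₁ * y₂)⁻¹, e₂, h₃, inv_mul_cancel_left]
  rw [transgress4, e₁, e₂, e₃]

/-- The loop is inserted in each of the five positions among `y₁, …, y₄`. In the alternating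
combination neighbouring insertions share the faces where the loop is multiplied into a `y`. The two
faces without loop cancel because the circle is closed. -/
theorem transgress4_cocycle {f : (Fin 4 → G) → Circle} (hf : ∀ g, coboundary f g = 1)
    {x₀ x₁ x₂ x₃ x₄ y₁ y₂ y₃ y₄ : G} (h₁ : x₀ * y₁ = y₁ * x₁) (h₂ : x₁ * y₂ = y₂ * x₂)
    (h₃ : x₂ * y₃ = y₃ * x₃) (h₄ : x₃ * y₄ = y₄ * x₄) :
    transgress4 f x₁ y₂ y₃ y₄ * transgress4 f x₀ y₁ (y₂ * y₃) y₄ * transgress4 f x₀ y₁ y₂ y₃ /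
      (transgress4 f x₀ (y₁ * y₂) y₃ y₄ * transgress4 f x₀ y₁ y₂ (y₃ * y₄)) = 1 := by
  have h₁₂ : x₀ * (y₁ * y₂) = y₁ * y₂ * x₂ := by rw [← mul_assoc, h₁, mul_assoc, h₂, mul_assoc]
  have h₂₃ : x₁ * (y₂ * y₃) = y₂ * y₃ * x₃ := by rw [← mul_assoc, h₂, mul_assoc, h₃, mul_assoc]
  have h₃₄ : x₂ * (y₃ * y₄) = y₃ * y₄ * x₄ := by rw [← mul_assoc, h₃, mul_assoc, h₄, mul_assoc]
  rw [transgress4_eq f h₂ h₃ h₄, transgress4_eq f h₁ h₂₃ h₄, transgress4_eq f h₁ h₂ h₃,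
    transgress4_eq f h₁₂ h₃ h₄, transgress4_eq f h₁ h₂ h₃₄]
  have c₀ := hf ![x₀, y₁, y₂, y₃, y₄]
  have c₁ := hf ![y₁, x₁, y₂, y₃, y₄]
  have c₂ := hf ![y₁, y₂, x₂, y₃, y₄]
  have c₃ := hf ![y₁, y₂, y₃, x₃, y₄]
  have c₄ := hf ![y₁, y₂, y₃, y₄, x₄]
  -- Rewriting every `yᵢ₊₁ xᵢ₊₁` as `xᵢ yᵢ₊₁` makes the shared faces syntactically equal; the rest
  -- is linear in `Additive Circle`.
  simp only [coboundary_four, ← h₁, ← h₂, ← h₃, ← h₄] at c₀ c₁ c₂ c₃ c₄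
  apply Additive.ofMul.injective
  apply_fun Additive.ofMul at c₀ c₁ c₂ c₃ c₄
  simp only [ofMul_mul, ofMul_div, ofMul_inv, ofMul_one] at c₀ c₁ c₂ c₃ c₄ ⊢
  linear_combination (norm := abel) c₀ - c₁ + c₂ - c₃ + c₄

/-- The same insertion argument one degree lower, with right-hand side `ω⁻¹`: the four values of `ω`
assemble into its transgression. -/
theorem transgress3_coboundary {f : (Fin 3 → G) → Circle} {ω : (Fin 4 → G) → Circle}
    (hf : ∀ g, coboundary f g = (ω g)⁻¹)
    {x₀ x₁ x₂ x₃ y₁ y₂ y₃ : G} (h₁ : x₀ * y₁ = y₁ * x₁) (h₂ : x₁ * y₂ = y₂ * x₂)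
    (h₃ : x₂ * y₃ = y₃ * x₃) :
    transgress3 f x₁ y₂ y₃ * transgress3 f x₀ y₁ (y₂ * y₃) /
      (transgress3 f x₀ (y₁ * y₂) y₃ * transgress3 f x₀ y₁ y₂) =
      (transgress4 ω x₀ y₁ y₂ y₃)⁻¹ := by
  have h₁₂ : x₀ * (y₁ * y₂) = y₁ * y₂ * x₂ := by rw [← mul_assoc, h₁, mul_assoc, h₂, mul_assoc]
  have h₂₃ : x₁ * (y₂ * y₃) = y₂ * y₃ * x₃ := by rw [← mul_assoc, h₂, mul_assoc, h₃, mul_assoc]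
  rw [transgress3_eq f h₂ h₃, transgress3_eq f h₁ h₂₃, transgress3_eq f h₁ h₂,
    transgress3_eq f h₁₂ h₃, transgress4_eq ω h₁ h₂ h₃]
  have c₀ := hf ![x₀, y₁, y₂, y₃]
  have c₁ := hf ![y₁, x₁, y₂, y₃]
  have c₂ := hf ![y₁, y₂, x₂, y₃]
  have c₃ := hf ![y₁, y₂, y₃, x₃]
  simp only [coboundary_three, ← h₁, ← h₂, ← h₃] at c₀ c₁ c₂ c₃
  apply Additive.ofMul.injective
  apply_fun Additive.ofMul at c₀ c₁ c₂ c₃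
  simp only [ofMul_mul, ofMul_div, ofMul_inv] at c₀ c₁ c₂ c₃ ⊢
  linear_combination (norm := abel) c₁ - c₀ - c₂ + c₃

theorem loop_comm {x y : LoopG G} (f : x ⟶ y) : fluxG x * eltG f = eltG f * fluxG y :=
  f.comm

theorem loopA_comm {A : Subgroup G} {x y : (loopA A).objs} (f : x ⟶ y) :
    fluxA x * eltA f = eltA f * fluxA y :=
  Subtype.ext (loop_comm f.1)

theorem isNormalizedCocycle3_T4 {π : (Fin 4 → G) → Circle} (hπ : IsNormalizedCocycle π) :
    IsNormalizedCocycle3 (T4 π) where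
  cocycle _ _ _ _ _ f g h k :=
    transgress4_cocycle hπ.2 (loop_comm f) (loop_comm g) (loop_comm h) (loop_comm k)
  id_left X Y Z f g := by
    rw [T4, transgress4_eq π (loop_comm (𝟙 X)) (loop_comm f) (loop_comm g)]
    have e : eltG (𝟙 X) = 1 := rfl
    rw [hπ.1 _ ⟨0, e⟩, hπ.1 _ ⟨0, e⟩, hπ.1 _ ⟨1, e⟩, hπ.1 _ ⟨0, e⟩]
    simp
  id_mid X Y Z f g := by
    rw [T4, transgress4_eq π (loop_comm f) (loop_comm (𝟙 Y)) (loop_comm g)]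
    have e : eltG (𝟙 Y) = 1 := rfl
    rw [hπ.1 _ ⟨2, e⟩, hπ.1 _ ⟨1, e⟩, hπ.1 _ ⟨2, e⟩, hπ.1 _ ⟨1, e⟩]
    simp
  id_right X Y Z f g := by
    rw [T4, transgress4_eq π (loop_comm f) (loop_comm g) (loop_comm (𝟙 Z))]
    have e : eltG (𝟙 Z) = 1 := rfl
    rw [hπ.1 _ ⟨3, e⟩, hπ.1 _ ⟨2, e⟩, hπ.1 _ ⟨3, e⟩, hπ.1 _ ⟨3, e⟩]
    simp

theorem isTwistedSubgroupoid_T3 {π : (Fin 4 → G) → Circle} {A : Subgroup G}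
    {l : (Fin 3 → A) → Circle} (hl : IsBoundaryCondition π A l) :
    IsTwistedSubgroupoid (T4 π) (loopA A) (T3 l) := by
  intro X Y Z W f g h
  -- The argument runs inside the group `A`, with `π` restricted to it; the values are compared in
  -- `G` afterwards.
  refine (transgress3_coboundary (ω := fun a : Fin 4 → A => π fun i => (a i : G)) hl.2 (loopA_comm f)
    (loopA_comm g) (loopA_comm h)).trans ?_
  rw [transgress4_eq _ (loopA_comm f) (loopA_comm g) (loopA_comm h), T4,
    transgress4_eq π (loop_comm ((loopA A).hom.map f)) (loop_comm ((loopA A).hom.map g))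
      (loop_comm ((loopA A).hom.map h))]
  congr 5 <;> (funext i; fin_cases i <;> rfl)

theorem T3_id_left {A : Subgroup G} {l : (Fin 3 → A) → Circle} (hl : IsNormalized l)
    {X Y : (loopA A).objs} (f : X ⟶ Y) : T3 l (𝟙 X) f = 1 := by
  have e : eltA (𝟙 X) = 1 := rfl
  rw [T3, transgress3_eq l (loopA_comm (𝟙 X)) (loopA_comm f), hl _ ⟨1, e⟩, hl _ ⟨0, e⟩,
    hl _ ⟨0, e⟩]
  simp

theorem T3_id_right {A : Subgroup G} {l : (Fin 3 → A) → Circle} (hl : IsNormalized l)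
    {X Y : (loopA A).objs} (f : X ⟶ Y) : T3 l f (𝟙 Y) = 1 := by
  have e : eltA (𝟙 Y) = 1 := rfl
  rw [T3, transgress3_eq l (loopA_comm f) (loopA_comm (𝟙 Y)), hl _ ⟨2, e⟩, hl _ ⟨1, e⟩,
    hl _ ⟨2, e⟩]
  simp

end Transgression

/-! ## Deloopings -/

section Deloop

variable {G : Type*} [Group G]

theorem isNormalizedCocycle3_deloop3 {α : (Fin 3 → G) → Circle} (hα : IsNormalizedCocycle α) :
    IsNormalizedCocycle3 (deloop3 α) where
  cocycle _ _ _ _ _ f g h k := by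
    have c := hα.2 ![Deloop.elt f, Deloop.elt g, Deloop.elt h, Deloop.elt k]
    rw [coboundary_three] at c
    refine Eq.trans ?_ c
    simp only [d3, deloop3, div_eq_mul_inv, mul_inv]
    apply Additive.ofMul.injective
    simp only [ofMul_mul, ofMul_inv]
    -- Composition in the delooping is multiplication by definition; this must be visible before
    -- `abel` can match terms.
    change Additive.ofMul _ + Additive.ofMul (α ![_, Deloop.elt g * Deloop.elt h, _]) + _ +
      (-Additive.ofMul (α ![Deloop.elt f * Deloop.elt g, _, _]) +
        -Additive.ofMul (α ![_, _, Deloop.elt h * Deloop.elt k])) = _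
    abel
  id_left _ _ _ _ _ := hα.1 _ ⟨0, rfl⟩
  id_mid _ _ _ _ _ := hα.1 _ ⟨1, rfl⟩
  id_right _ _ _ _ _ := hα.1 _ ⟨2, rfl⟩

theorem isTwistedSubgroupoid_deloop2 {α : (Fin 3 → G) → Circle} {A : Subgroup G}
    {φ : (Fin 2 → A) → Circle} (hφ : IsBoundaryCondition α A φ) :
    IsTwistedSubgroupoid (deloop3 α) (deloopSubgroup A) (deloop2 φ) := by
  intro X Y Z W f g h
  have c := hφ.2 ![eltD f, eltD g, eltD h]
  rw [coboundary_two] at c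
  refine Eq.trans ?_ (c.trans ?_)
  · simp only [d2, deloop2, div_eq_mul_inv, mul_inv]
    apply Additive.ofMul.injective
    simp only [ofMul_mul, ofMul_inv]
    change Additive.ofMul _ + Additive.ofMul (φ ![_, eltD g * eltD h]) +
      (-Additive.ofMul (φ ![eltD f * eltD g, _]) + _) = _
    abel
  · refine congrArg (fun a => (α a)⁻¹) ?_
    funext i
    fin_cases i <;> rfl

end Deloop

/-! ## The twisting cocycle of a relative groupoid -/

section RelativeGroupoid

universe v u

variable {C : Type u} [Groupoid.{v} C] {S T : Subgroupoid C}

/-- Three composable commuting squares triangulate a tetrahedron times an interval by four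
staircases, one cocycle equation for each. Inner faces cancel; the pure `S`-face and the pure
`T`-face remain, and are absorbed by the equations for `φ` and `ψ`. -/
theorem isNormalizedCocycle2_relTwist {α : Cochain3 C} {φ : Cochain2 S.objs}
    {ψ : Cochain2 T.objs} (hα : IsNormalizedCocycle3 α) (hφ : IsTwistedSubgroupoid α S φ)
    (hψ : IsTwistedSubgroupoid α T ψ) (hφl : ∀ ⦃X Y : S.objs⦄ (f : X ⟶ Y), φ (𝟙 X) f = 1)
    (hφr : ∀ ⦃X Y : S.objs⦄ (f : X ⟶ Y), φ f (𝟙 Y) = 1)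
    (hψl : ∀ ⦃X Y : T.objs⦄ (f : X ⟶ Y), ψ (𝟙 X) f = 1)
    (hψr : ∀ ⦃X Y : T.objs⦄ (f : X ⟶ Y), ψ f (𝟙 Y) = 1) :
    IsNormalizedCocycle2 (relTwist α φ ψ) where
  cocycle X Y Z W f g h := by
    have c₀ := hα.cocycle (S.hom.map f.left) (S.hom.map g.left) (S.hom.map h.left) W.hom
    have c₁ := hα.cocycle (S.hom.map f.left) (S.hom.map g.left) Z.hom (T.hom.map h.right)
    have c₂ := hα.cocycle (S.hom.map f.left) Y.hom (T.hom.map g.right) (T.hom.map h.right)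
    have c₃ := hα.cocycle X.hom (T.hom.map f.right) (T.hom.map g.right) (T.hom.map h.right)
    have d₀ := hφ f.left g.left h.left
    have d₁ := hψ f.right g.right h.right
    -- The commuting squares `f.w`, `g.w`, `h.w` identify the faces shared by adjacent staircases.
    simp only [d3, d2, f.w, g.w, h.w] at c₀ c₁ c₂ c₃ d₀ d₁
    simp only [d2, relTwist, Comma.comp_left, Comma.comp_right, Functor.map_comp]
    apply Additive.ofMul.injective
    apply_fun Additive.ofMul at c₀ c₁ c₂ c₃ d₀ d₁
    simp only [ofMul_mul, ofMul_div, ofMul_inv, ofMul_one] at c₀ c₁ c₂ c₃ d₀ d₁ ⊢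
    linear_combination (norm := abel) c₀ - c₁ + c₂ - c₃ - d₀ + d₁
  id_left X Y f := by
    simp [relTwist, hφl, hψl, hα.id_left, hα.id_mid]
  id_right X Y f := by
    simp [relTwist, hφr, hψr, hα.id_right, hα.id_mid]

end RelativeGroupoid

/-! ## Twisted groupoid algebras -/

section TwistedProduct

universe v u

variable {C : Type u} [Category.{v} C] {θ : Cochain2 C}

theorem twistedProduct_comp (θ : Cochain2 C) {X Y Z : C} (f : X ⟶ Y) (g : Y ⟶ Z) :
    twistedProduct θ (Finsupp.single ⟨f⟩ 1) (Finsupp.single ⟨g⟩ 1) =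
      Finsupp.single ⟨f ≫ g⟩ (θ f g : ℂ) := by
  simp [twistedProduct]

theorem twistedProduct_of_ne (θ : Cochain2 C) {f g : Mor C} (h : f.tgt ≠ g.src) :
    twistedProduct θ (Finsupp.single f 1) (Finsupp.single g 1) = 0 := by
  simp [twistedProduct, h]

theorem twistedProduct_assoc (hθ : IsNormalizedCocycle2 θ) (x y z : Mor C →₀ ℂ) :
    twistedProduct θ (twistedProduct θ x y) z = twistedProduct θ x (twistedProduct θ y z) := by
  induction x using Finsupp.induction_linear with
  | zero => simp
  | add x x' hx hx' => simp only [map_add, LinearMap.add_apply, hx, hx']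
  | single f a =>
  induction y using Finsupp.induction_linear with
  | zero => simp
  | add x x' hx hx' => simp only [map_add, LinearMap.add_apply, hx, hx']
  | single g b =>
  induction z using Finsupp.induction_linear with
  | zero => simp
  | add x x' hx hx' => simp only [map_add, hx, hx']
  | single h c =>
  have e : ∀ (i : Mor C) (t : ℂ), Finsupp.single i t = t • Finsupp.single i 1 := fun i t => by
    simp
  rw [e f a, e g b, e h c]
  simp only [map_smul, LinearMap.smul_apply]
  congr 3
  obtain ⟨f⟩ := f
  obtain ⟨g⟩ := g
  obtain ⟨h⟩ := h
  rename_i X Y Y' Z Z' W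
  by_cases hY : Y = Y'
  swap
  · rw [twistedProduct_of_ne θ hY]
    by_cases hZ : Z = Z'
    · subst hZ
      rw [twistedProduct_comp, e ⟨g ≫ h⟩, map_smul,
        twistedProduct_of_ne (f := ⟨f⟩) (g := ⟨g ≫ h⟩) θ hY]
      simp
    · rw [twistedProduct_of_ne (f := ⟨g⟩) θ hZ]
      simp
  subst hY
  by_cases hZ : Z = Z'
  swap
  · rw [twistedProduct_of_ne (f := ⟨g⟩) θ hZ, twistedProduct_comp, e, map_smul,
      LinearMap.smul_apply, twistedProduct_of_ne θ hZ]
    simp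
  subst hZ
  rw [twistedProduct_comp, twistedProduct_comp, e, e _ (θ g h : ℂ), map_smul, map_smul,
    LinearMap.smul_apply, twistedProduct_comp, twistedProduct_comp, Finsupp.smul_single,
    Finsupp.smul_single, Category.assoc]
  have c := hθ.cocycle f g h
  rw [d2, div_eq_one] at c
  simp only [smul_eq_mul, ← Circle.coe_mul]
  rw [c, mul_comm]

/-- The unit is the sum of all identity morphisms; normalisation of `θ` makes its structure
constants trivial, and finiteness of the set of objects makes the sum available. -/
theorem isUnitalAssoc_twistedProduct [Finite C] (hθ : IsNormalizedCocycle2 θ) :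
    IsUnitalAssoc (twistedProduct θ) := by
  classical
  have := Fintype.ofFinite C
  refine ⟨twistedProduct_assoc hθ, ∑ X : C, Finsupp.single ⟨𝟙 X⟩ 1, fun x => ?_⟩
  induction x using Finsupp.induction_linear with
  | zero => simp
  | add x y hx hy => simp only [map_add, LinearMap.add_apply, hx.1, hx.2, hy.1, hy.2, and_self]
  | single f a =>
    obtain ⟨f⟩ := f
    rename_i X Y
    rw [← mul_one a, ← smul_eq_mul, ← Finsupp.smul_single, map_smul, map_smul,
      LinearMap.smul_apply, map_sum, LinearMap.sum_apply, map_sum]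
    constructor
    · rw [Finset.sum_eq_single X, twistedProduct_comp, hθ.id_left, Category.id_comp,
        Circle.coe_one]
      · exact fun Z _ hZ => twistedProduct_of_ne θ hZ
      · exact fun h => absurd (Finset.mem_univ _) h
    · rw [Finset.sum_eq_single Y, twistedProduct_comp, hθ.id_right, Category.comp_id,
        Circle.coe_one]
      · exact fun Z _ hZ => twistedProduct_of_ne θ hZ.symm
      · exact fun h => absurd (Finset.mem_univ _) h

theorem IsUnitalAssoc.of_linearEquiv {M N : Type*} [AddCommGroup M] [Module ℂ M]
    [AddCommGroup N] [Module ℂ N] {p : M →ₗ[ℂ] M →ₗ[ℂ] M} {q : N →ₗ[ℂ] N →ₗ[ℂ] N}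
    (hq : IsUnitalAssoc q) (Φ : M ≃ₗ[ℂ] N) (h : ∀ x y, Φ (p x y) = q (Φ x) (Φ y)) :
    IsUnitalAssoc p := by
  obtain ⟨hq, e, he⟩ := hq
  refine ⟨fun x y z => Φ.injective ?_, Φ.symm e, fun x => ⟨Φ.injective ?_, Φ.injective ?_⟩⟩
  · rw [h, h, h, h, hq]
  · rw [h, Φ.apply_symm_apply, (he _).1]
  · rw [h, Φ.apply_symm_apply, (he _).2]

end TwistedProduct

/-! ## Action groupoids -/

universe v u

/-- A presentation of a category as the action groupoid of a right action of a group `H` on a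
type `X`. -/
structure ActionPresentation {X H : Type*} [Group H] (act : X → H → X) (C : Type u)
    [Category.{v} C] where
  obj : X → C
  obj_bijective : Function.Bijective obj
  act_mul : ∀ x h k, act x (h * k) = act (act x h) k
  hom : ∀ {x y : X} (h : H), y = act x h → (obj x ⟶ obj y)
  label : ∀ {Y Z : C}, (Y ⟶ Z) → H
  label_hom : ∀ {x y : X} (h : H) (hy : y = act x h), label (hom h hy) = h
  exists_hom : ∀ {x y : X} (f : obj x ⟶ obj y), ∃ h hy, hom h hy = f
  hom_comp : ∀ {x y z : X} (h k : H) (hy : y = act x h) (hz : z = act y k)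
    (hz' : z = act x (h * k)), hom h hy ≫ hom k hz = hom (h * k) hz'

namespace ActionPresentation

variable {X H : Type*} [Group H] {act : X → H → X} {C : Type u} [Category.{v} C]
  (D : ActionPresentation act C)

/-- The morphism with source `x` given by the group element `h`. -/
def mor (q : X × H) : Mor C := ⟨D.hom (x := q.1) q.2 rfl⟩

theorem mor_bijective : Function.Bijective D.mor := by
  constructor
  · intro q q' h
    have h1 := congrArg Mor.src h
    have h2 := congrArg (fun f : Mor C => D.label f.hom) h
    simp only [mor, D.label_hom] at h2
    exact Prod.ext (D.obj_bijective.1 h1) h2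
  · rintro ⟨f⟩
    rename_i Y Z
    obtain ⟨x, rfl⟩ := D.obj_bijective.2 Y
    obtain ⟨y, rfl⟩ := D.obj_bijective.2 Z
    obtain ⟨h, rfl, rfl⟩ := D.exists_hom f
    exact ⟨(x, h), rfl⟩

/-- A `2`-cochain on an action groupoid, as a function of a source and two group elements. -/
def cochain (θ : Cochain2 C) (x : X) (h k : H) : Circle :=
  θ (D.hom (x := x) h rfl) (D.hom k rfl)

/-- Keeping the target as a variable with an equation lets composites be compared without transport
along equalities of objects. -/
theorem apply_hom (θ : Cochain2 C) {x y z : X} (h k : H) (hy : y = act x h) (hz : z = act y k) :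
    θ (D.hom h hy) (D.hom k hz) = D.cochain θ x h k := by
  subst hy hz
  rfl

theorem cochain_cocycle {θ : Cochain2 C} (hθ : IsNormalizedCocycle2 θ) (x : X) (h k l : H) :
    D.cochain θ x h k * D.cochain θ x (h * k) l =
      D.cochain θ (act x h) k l * D.cochain θ x h (k * l) := by
  have c := hθ.cocycle (D.hom (x := x) h rfl) (D.hom k rfl) (D.hom l rfl)
  rw [d2, D.hom_comp h k rfl rfl (D.act_mul x h k).symm,
    D.hom_comp k l rfl rfl (D.act_mul _ k l).symm, D.apply_hom θ, D.apply_hom θ, D.apply_hom θ,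
    D.apply_hom θ, div_eq_one] at c
  rw [c, mul_comm]

theorem twistedProduct_mor [DecidableEq X] (θ : Cochain2 C) (x x' : X) (h h' : H) :
    twistedProduct θ (Finsupp.single (D.mor (x, h)) 1) (Finsupp.single (D.mor (x', h')) 1) =
      if act x h = x' then Finsupp.single (D.mor (x, h * h')) (D.cochain θ x h h' : ℂ) else 0 := by
  split_ifs with hx
  · subst hx
    refine (twistedProduct_comp θ (D.hom (x := x) h rfl) (D.hom h' rfl)).trans ?_
    rw [D.hom_comp h h' rfl rfl (D.act_mul x h h').symm]
    refine congrArg (fun f => Finsupp.single f (D.cochain θ x h h' : ℂ)) ?_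
    have : ∀ y (hy : y = act x (h * h')), (⟨D.hom _ hy⟩ : Mor C) = D.mor (x, h * h') := by
      rintro y rfl
      rfl
    exact this _ _
  · exact twistedProduct_of_ne θ fun e => hx (D.obj_bijective.1 e)

end ActionPresentation

/-! ## The star product of a tube whose colourings form an action groupoid -/

section Star

variable {G : Type*} [Group G] {A B : Subgroup G} {U U' W₁ W₂ : Type} {k : ℕ}

/-- A bulk colouring has only one restriction to the target, so the sum over target colourings
collapses. The bulk colourings extending `c₀` are enumerated by `J`, the remaining degrees of
freedom. -/
theorem partitionFunction_single [Finite G] [DecidableEq W₁] [DecidableEq U] [DecidableEq U']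
    [Finite W₁] [Finite U'] {S : Complex (k + 2) (U × Bool)} {T : Complex (k + 2) (U' × Bool)}
    (ω : (Fin (k + 2) → G) → Circle) (φ : (Fin (k + 1) → A) → Circle)
    (ψ : (Fin (k + 1) → B) → Circle) (M : Cobordism S T W₁) {I J : Type*} [Finite I] [Fintype J]
    {e : I → Colouring M.bulk A B} (he : Function.Bijective e) {t : I → Colouring T A B}
    (ht : ∀ i c, (e i).RestrictsTo M.tgt c ↔ t i = c) (c₀ : Colouring S A B) {j : J → I}
    (hj : Function.Injective j) (hs : ∀ i, (e i).RestrictsTo M.src c₀ ↔ i ∈ Set.range j) :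
    partitionFunction ω φ ψ M (Finsupp.single c₀ 1) = (normalisation M A B : ℂ) •
      ∑ i : J, Finsupp.single (t (j i)) (weight ω φ ψ (e (j i)) : ℂ) := by
  classical
  have := Fintype.ofFinite I
  rw [partitionFunction, Finsupp.linearCombination_single, one_smul]
  congr 1
  rw [← he.sum_comp]
  refine (Fintype.sum_of_injective j hj _ _ (fun i hi => ?_) (fun i => ?_)).symm
  · exact Finset.sum_eq_zero fun c _ => if_neg fun h => hi ((hs i).1 h.1)
  · rw [Finset.sum_eq_single (t (j i)), if_pos ⟨(hs _).2 ⟨i, rfl⟩, (ht _ _).2 rfl⟩]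
    · exact fun c _ hc => if_neg fun h => hc ((ht _ _).1 h.2).symm
    · exact fun h => absurd (Finset.mem_univ _) h

/-- The data identifying the colourings of a tube, and of the complexes that define its product,
with the chains of composable morphisms of the action groupoid of a group `H`. A chain starting
at `x` is given by the composites `P i` of its first `i` morphisms. -/
structure ChainData {X H : Type*} [Group H] (act : X → H → X) (A B : Subgroup G)
    {S : Complex (k + 2) (U × Bool)} {T : Complex (k + 2) (U' × Bool)} (ι₁ ι₂ : U' → U)
    (P : Cobordism S S W₁) (Q : Cobordism S T W₂) where
  cT : X → (Fin 2 → H) → Colouring T A B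
  cS : X → (Fin 3 → H) → Colouring S A B
  cQ : X → (Fin 3 → H) → Colouring Q.bulk A B
  cP : X → (Fin 4 → H) → Colouring P.bulk A B
  bijective_T : Function.Bijective fun q : X × (Fin 1 → H) => cT q.1 (Fin.cons 1 q.2)
  bijective_S : Function.Bijective fun q : X × (Fin 2 → H) => cS q.1 (Fin.cons 1 q.2)
  bijective_Q : Function.Bijective fun q : X × (Fin 2 → H) => cQ q.1 (Fin.cons 1 q.2)
  bijective_P : Function.Bijective fun q : X × (Fin 3 → H) => cP q.1 (Fin.cons 1 q.2)
  translate : ∀ x h R, cT x (fun i => h * R i) = cT (act x h) R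
  restrict_fst : ∀ x R c, (cS x R).RestrictsTo ι₁ c ↔ cT x (R ∘ ![0, 1]) = c
  restrict_snd : ∀ x R c, (cS x R).RestrictsTo ι₂ c ↔ cT x (R ∘ ![1, 2]) = c
  restrict_P_src : ∀ x R c, (cP x R).RestrictsTo P.src c ↔ cS x (R ∘ ![0, 1, 3]) = c
  restrict_P_tgt : ∀ x R c, (cP x R).RestrictsTo P.tgt c ↔ cS x (R ∘ ![0, 2, 3]) = c
  restrict_Q_src : ∀ x R c, (cQ x R).RestrictsTo Q.src c ↔ cS x R = c
  restrict_Q_tgt : ∀ x R c, (cQ x R).RestrictsTo Q.tgt c ↔ cT x (R ∘ ![0, 2]) = c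

namespace ChainData

variable {X H : Type*} [Group H] {act : X → H → X} {S : Complex (k + 2) (U × Bool)}
  {T : Complex (k + 2) (U' × Bool)} {ι₁ ι₂ : U' → U} {P : Cobordism S S W₁}
  {Q : Cobordism S T W₂} (D : ChainData act A B ι₁ ι₂ P Q)

theorem tube_bijective : Function.Bijective fun q : X × H => D.cT q.1 ![1, q.2] := by
  convert D.bijective_T.comp
    ((Equiv.refl X).prodCongr (Equiv.funUnique (Fin 1) H).symm).bijective using 1
  funext q
  refine congrArg (D.cT q.1) ?_
  funext i
  fin_cases i <;> rfl

theorem cT_inj {x x' : X} {h h' : H} :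
    D.cT x ![1, h] = D.cT x' ![1, h'] ↔ x = x' ∧ h = h' := by
  refine (D.tube_bijective.1.eq_iff (a := (x, h)) (b := (x', h'))).trans ?_
  exact Prod.mk_inj

theorem cS_inj {x x' : X} {h h' l l' : H} :
    D.cS x ![1, h, l] = D.cS x' ![1, h', l'] ↔ x = x' ∧ h = h' ∧ l = l' := by
  refine (D.bijective_S.1.eq_iff (a := (x, ![h, l])) (b := (x', ![h', l']))).trans ?_
  simp [funext_iff, Fin.forall_fin_two]

variable [Finite G] [Finite X] [Finite H]

theorem gluing_single [Finite U] [DecidableEq X] (x x' : X) (h h' : H) :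
    gluing S T A B ι₁ ι₂ (Finsupp.single (D.cT x ![1, h]) 1)
      (Finsupp.single (D.cT x' ![1, h']) 1) =
      if act x h = x' then Finsupp.single (D.cS x ![1, h, h * h']) 1 else 0 := by
  classical
  have := Fintype.ofFinite X
  have := Fintype.ofFinite H
  have hc : ∀ q : X × (Fin 2 → H), ((D.cS q.1 (Fin.cons 1 q.2)).RestrictsTo ι₁ (D.cT x ![1, h]) ∧
      (D.cS q.1 (Fin.cons 1 q.2)).RestrictsTo ι₂ (D.cT x' ![1, h'])) ↔
      act x h = x' ∧ q = (x, ![h, h * h']) := by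
    rintro ⟨y, R⟩
    have h1 : (Fin.cons 1 R : Fin 3 → H) ∘ ![0, 1] = ![1, R 0] := by
      funext i
      fin_cases i <;> rfl
    -- The second tube starts at the middle vertex, so its composites carry the factor `R 0`;
    -- translation turns it into the shifted starting object `act x (R 0)`.
    have h2 : (Fin.cons 1 R : Fin 3 → H) ∘ ![1, 2] =
        fun i => R 0 * (![1, (R 0)⁻¹ * R 1] : Fin 2 → H) i := by
      funext i
      fin_cases i
      · exact (mul_one _).symm
      · exact (mul_inv_cancel_left _ _).symm
    rw [D.restrict_fst, D.restrict_snd, h1, h2, D.translate, D.cT_inj, D.cT_inj,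
      inv_mul_eq_iff_eq_mul, Prod.mk_inj]
    constructor
    · rintro ⟨⟨rfl, rfl⟩, rfl, e⟩
      refine ⟨rfl, rfl, ?_⟩
      rw [← e]
      funext i
      fin_cases i <;> rfl
    · rintro ⟨rfl, rfl, rfl⟩
      simp
  simp only [gluing, Finsupp.linearCombination_single, one_smul]
  rw [← D.bijective_S.sum_comp]
  simp only [hc]
  split_ifs with hx
  · simp only [hx, true_and, Finset.sum_ite_eq', Finset.mem_univ, if_true]
    rfl
  · simp [hx]

variable [DecidableEq U] (ω : (Fin (k + 2) → G) → Circle) (φ : (Fin (k + 1) → A) → Circle)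
  (ψ : (Fin (k + 1) → B) → Circle)

/-- All vertices of the triangle already lie on the source, so there is a single extension, indexed
by `Unit`. -/
theorem partitionFunction_Q [DecidableEq U'] [DecidableEq W₂] [Finite U'] [Finite W₂] (x : X) (h l : H) :
    partitionFunction ω φ ψ Q (Finsupp.single (D.cS x ![1, h, l]) 1) =
      (normalisation Q A B : ℂ) •
        Finsupp.single (D.cT x ![1, l]) (weight ω φ ψ (D.cQ x ![1, h, l]) : ℂ) := by
  have h1 : ∀ R : Fin 3 → H, R ∘ ![0, 2] = ![R 0, R 2] := fun R => by
    funext i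
    fin_cases i <;> rfl
  refine (partitionFunction_single ω φ ψ Q D.bijective_Q
    (t := fun q => D.cT q.1 ((Fin.cons 1 q.2 : Fin 3 → H) ∘ ![0, 2]))
    (fun _ _ => D.restrict_Q_tgt _ _ _) _ (j := fun _ : Unit => (x, ![h, l]))
    (fun _ _ _ => rfl) fun q => ?_).trans ?_
  · obtain ⟨y, R⟩ := q
    rw [D.restrict_Q_src]
    refine (D.bijective_S.1.eq_iff (a := (y, R)) (b := (x, ![h, l]))).trans ?_
    simp [eq_comm]
  · simp only [Finset.univ_unique, Finset.sum_singleton, h1]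
    rfl

/-- The one vertex of the bulk chain outside the source is the new middle vertex `1̃`, whose
composite `j` ranges freely over `H`. -/
theorem partitionFunction_P [Fintype H] [DecidableEq W₁] [Finite U] [Finite W₁] (x : X) (h l : H) :
    partitionFunction ω φ ψ P (Finsupp.single (D.cS x ![1, h, l]) 1) =
      (normalisation P A B : ℂ) • ∑ j : H,
        Finsupp.single (D.cS x ![1, j, l]) (weight ω φ ψ (D.cP x ![1, h, j, l]) : ℂ) := by
  have h1 : ∀ R : Fin 3 → H, (Fin.cons 1 R : Fin 4 → H) ∘ ![0, 2, 3] = ![1, R 1, R 2] :=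
    fun R => by
      funext i
      fin_cases i <;> rfl
  have h2 : ∀ R : Fin 3 → H, (Fin.cons 1 R : Fin 4 → H) ∘ ![0, 1, 3] = ![1, R 0, R 2] :=
    fun R => by
      funext i
      fin_cases i <;> rfl
  refine (partitionFunction_single ω φ ψ P D.bijective_P
    (t := fun q => D.cS q.1 ((Fin.cons 1 q.2 : Fin 4 → H) ∘ ![0, 2, 3]))
    (fun _ _ => D.restrict_P_tgt _ _ _) _ (j := fun j : H => (x, ![h, j, l]))
    (fun j j' e => ?_) fun q => ?_).trans ?_
  · simpa using congrArg (fun q : X × (Fin 3 → H) => q.2 1) e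
  · obtain ⟨y, R⟩ := q
    rw [D.restrict_P_src, h2, D.cS_inj]
    constructor
    · rintro ⟨rfl, rfl, rfl⟩
      refine ⟨R 1, Prod.ext rfl ?_⟩
      funext i
      fin_cases i <;> rfl
    · rintro ⟨j, e⟩
      obtain ⟨rfl, rfl⟩ := Prod.mk_inj.1 e
      exact ⟨rfl, rfl, rfl⟩
  · simp only [h1]
    rfl

/-- The star product of two basis states, when the weights of the triangulation change are
given by a cocycle `θ` and those of the projector by quotients of its values. -/
theorem starProduct_single [DecidableEq U'] [DecidableEq W₁] [DecidableEq W₂] [Finite U]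
    [Finite U'] [Finite W₁] [Finite W₂] [DecidableEq X] {θ : X → H → H → Circle}
    (hθ : ∀ x h j l, θ x h j * θ x (h * j) l = θ (act x h) j l * θ x h (j * l))
    (hQ : ∀ x h l, weight ω φ ψ (D.cQ x ![1, h, l]) = θ x h (h⁻¹ * l))
    (hP : ∀ x h j l, weight ω φ ψ (D.cP x ![1, h, j, l]) =
      θ x h (h⁻¹ * j) / θ (act x h) (h⁻¹ * j) (j⁻¹ * l)) (x x' : X) (h h' : H) :
    starProduct ω φ ψ ι₁ ι₂ P Q (Finsupp.single (D.cT x ![1, h]) 1)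
      (Finsupp.single (D.cT x' ![1, h']) 1) =
      if act x h = x' then Finsupp.single (D.cT x ![1, h * h'])
        ((normalisation Q A B * (normalisation P A B * Nat.card H) : ℝ) * θ x h h' : ℂ)
      else 0 := by
  have := Fintype.ofFinite H
  rw [starProduct, LinearMap.compr₂_apply, D.gluing_single]
  split_ifs with hx
  swap
  · simp
  have e : ∀ (i : Colouring S A B) (t : ℂ), Finsupp.single i t = t • Finsupp.single i 1 :=
    fun i t => by simp
  rw [LinearMap.comp_apply, D.partitionFunction_P, map_smul, map_sum]
  -- Each summand is independent of `j`, so the sum only produces the factor `Nat.card H`.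
  have key : ∀ j : H, partitionFunction ω φ ψ Q (Finsupp.single (D.cS x ![1, j, h * h'])
      (weight ω φ ψ (D.cP x ![1, h, j, h * h']) : ℂ)) =
      Finsupp.single (D.cT x ![1, h * h']) ((normalisation Q A B : ℂ) * θ x h h') := by
    intro j
    rw [e, map_smul, D.partitionFunction_Q, hP, hQ, Finsupp.smul_single, Finsupp.smul_single]
    congr 1
    -- The cocycle identity for `h`, `h⁻¹j`, `j⁻¹hh'`, whose successive composites are `j` and
    -- `hh'`.
    have c := hθ x h (h⁻¹ * j) (j⁻¹ * (h * h'))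
    rw [mul_inv_cancel_left, mul_assoc h⁻¹, mul_inv_cancel_left, inv_mul_cancel_left] at c
    have c' : θ x h (h⁻¹ * j) / θ (act x h) (h⁻¹ * j) (j⁻¹ * (h * h')) *
        θ x j (j⁻¹ * (h * h')) = θ x h h' := by
      rw [div_mul_eq_mul_div, c, mul_div_cancel_left]
    rw [← c', Circle.coe_mul, smul_eq_mul, smul_eq_mul]
    ring
  simp only [key, Finset.sum_const, Finset.card_univ, ← Nat.card_eq_fintype_card,
    Finsupp.smul_single, nsmul_eq_mul, smul_eq_mul]
  congr 1
  push_cast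
  ring

end ChainData

/-- The tube algebra of a tube whose colourings form an action groupoid is isomorphic to the
twisted groupoid algebra. -/
theorem exists_tubeAlgebra_iso {X H : Type*} [Group H] {act : X → H → X} [Finite G] [Finite X]
    [Finite H] [Finite U] [Finite U'] [DecidableEq W₁] [DecidableEq W₂] [DecidableEq U]
    [DecidableEq U'] [Finite W₁] [Finite W₂] {S : Complex (k + 2) (U × Bool)}
    {T : Complex (k + 2) (U' × Bool)} {ι₁ ι₂ : U' → U} {P : Cobordism S S W₁}
    {Q : Cobordism S T W₂} (D : ChainData act A B ι₁ ι₂ P Q)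
    (ω : (Fin (k + 2) → G) → Circle) (φ : (Fin (k + 1) → A) → Circle)
    (ψ : (Fin (k + 1) → B) → Circle) {C : Type u} [Category.{v} C]
    (E : ActionPresentation act C) {θ : Cochain2 C} (hθ : IsNormalizedCocycle2 θ)
    (hQ : ∀ x h l, weight ω φ ψ (D.cQ x ![1, h, l]) = E.cochain θ x h (h⁻¹ * l))
    (hP : ∀ x h j l, weight ω φ ψ (D.cP x ![1, h, j, l]) =
      E.cochain θ x h (h⁻¹ * j) / E.cochain θ (act x h) (h⁻¹ * j) (j⁻¹ * l)) {N : ℝ} (hN : N ≠ 0)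
    (hnorm : normalisation Q A B * (normalisation P A B * Nat.card H) = N) :
    IsUnitalAssoc (twistedProduct θ) ∧ IsUnitalAssoc (starProduct ω φ ψ ι₁ ι₂ P Q) ∧
    ∃ (e : Colouring T A B ≃ Mor C) (Φ : States T A B ≃ₗ[ℂ] (Mor C →₀ ℂ)),
      (∀ x h, e (D.cT x ![1, h]) = E.mor (x, h)) ∧
      (∀ c, Φ (Finsupp.single c 1) = (N : ℂ) • Finsupp.single (e c) 1) ∧
      ∀ x y, Φ (starProduct ω φ ψ ι₁ ι₂ P Q x y) = twistedProduct θ (Φ x) (Φ y) := by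
  classical
  have : Finite C := Finite.of_surjective _ E.obj_bijective.2
  let e : Colouring T A B ≃ Mor C :=
    (Equiv.ofBijective _ D.tube_bijective).symm.trans (Equiv.ofBijective _ E.mor_bijective)
  have he : ∀ x h, e (D.cT x ![1, h]) = E.mor (x, h) := fun x h =>
    congrArg E.mor ((Equiv.ofBijective _ D.tube_bijective).symm_apply_apply (x, h))
  -- Tube structure constants are `N` times those of the groupoid algebra. Scaling basis vectors by
  -- `N` balances this: both sides acquire `N²`.
  let Φ : States T A B ≃ₗ[ℂ] (Mor C →₀ ℂ) :=
    (Finsupp.domLCongr e).trans (LinearEquiv.smulOfNeZero ℂ _ (N : ℂ) (by exact_mod_cast hN))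
  have hΦ : ∀ c, Φ (Finsupp.single c 1) = (N : ℂ) • Finsupp.single (e c) 1 := fun c => by
    simp [Φ]
  have hmul : ∀ x y, Φ (starProduct ω φ ψ ι₁ ι₂ P Q x y) = twistedProduct θ (Φ x) (Φ y) := by
    have : (starProduct ω φ ψ ι₁ ι₂ P Q).compr₂ Φ.toLinearMap =
        (twistedProduct θ).compl₁₂ Φ.toLinearMap Φ.toLinearMap := by
      refine Finsupp.lhom_ext' fun c => LinearMap.ext_ring ?_
      refine Finsupp.lhom_ext' fun c' => LinearMap.ext_ring ?_
      obtain ⟨⟨x, h⟩, rfl⟩ := D.tube_bijective.2 c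
      obtain ⟨⟨x', h'⟩, rfl⟩ := D.tube_bijective.2 c'
      simp only [LinearMap.comp_apply, Finsupp.lsingle_apply, LinearMap.compr₂_apply,
        LinearMap.compl₁₂_apply, LinearEquiv.coe_coe, hΦ, he, map_smul, LinearMap.smul_apply,
        D.starProduct_single ω φ ψ (E.cochain_cocycle hθ) hQ hP, E.twistedProduct_mor, hnorm]
      split_ifs
      · have e1 : ∀ (i : Colouring T A B) (t : ℂ),
            Finsupp.single i t = t • Finsupp.single i 1 := fun i t => by simp
        rw [e1, map_smul, hΦ, he]
        simp only [Finsupp.smul_single, smul_eq_mul]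
        congr 1
        ring
      · simp
    intro x y
    exact congrArg (fun f => f x y) this
  have hu := isUnitalAssoc_twistedProduct hθ
  exact ⟨hu, hu.of_linearEquiv Φ hmul, e, Φ, he, hΦ, hmul⟩

end Star

/-! ## Presentations of the relative groupoids -/

section Presentations

variable {G : Type*} [Group G] (A B : Subgroup G)

/-- The relative groupoid `G_{AB}` is the action groupoid of `A × B` on `G`. -/
def groupPresentation :
    ActionPresentation (fun (g : G) (k : A × B) => (k.1 : G)⁻¹ * g * k.2)
      (RelGroupoid (deloopSubgroup A) (deloopSubgroup B)) where
  obj g :=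
    { left := ⟨⟨⟩, ⟨(1 : G), A.one_mem⟩⟩
      right := ⟨⟨⟩, ⟨(1 : G), B.one_mem⟩⟩
      hom := g }
  obj_bijective := by
    refine ⟨fun g g' h => congrArg (fun Y => Deloop.elt (Comma.hom Y)) h, ?_⟩
    rintro ⟨⟨⟨⟩, _⟩, ⟨⟨⟩, _⟩, g⟩
    exact ⟨g, rfl⟩
  act_mul x h k := by
    simp only [Prod.fst_mul, Prod.snd_mul, Subgroup.coe_mul]
    group
  hom {x y} h hy :=
    { left := ⟨(h.1 : G), h.1.2⟩
      right := ⟨(h.2 : G), h.2.2⟩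
      w := by
        change (h.1 : G) * y = x * h.2
        rw [hy]
        group }
  label f := (eltD f.left, eltD f.right)
  label_hom _ _ := rfl
  exists_hom {x y} f := by
    have hw : (eltD f.left : G) * y = x * eltD f.right := f.w
    refine ⟨(eltD f.left, eltD f.right), ?_, rfl⟩
    rw [mul_assoc, ← hw, inv_mul_cancel_left]
  hom_comp _ _ _ _ _ := rfl

/-- The relative groupoid `ΛG_{ΛA ΛB}` is an action groupoid of `A × B`. -/
def loopPresentation :
    ActionPresentation (LoopObj.act (A := A) (B := B)) (RelGroupoid (loopA A) (loopA B)) where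
  obj x :=
    { left := ⟨⟨⟨⟩, x.1.2⟩, ⟨𝟙 _, x.2.1, A.one_mem⟩⟩
      right := ⟨⟨⟨⟩, (x.1.1⁻¹ * x.1.2 * x.1.1 : G)⟩, ⟨𝟙 _, x.2.2, B.one_mem⟩⟩
      hom := ⟨x.1.1, by
        change x.1.2 * x.1.1 = x.1.1 * (x.1.1⁻¹ * x.1.2 * x.1.1)
        group⟩ }
  obj_bijective := by
    refine ⟨fun x x' h => Subtype.ext (Prod.ext (congrArg (fun Y => eltG (Comma.hom Y)) h)
      (congrArg
      (fun Y : RelGroupoid (loopA A) (loopA B) => fluxG Y.left.1) h)), ?_⟩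
    rintro ⟨⟨⟨⟨⟩, z⟩, hz⟩, ⟨⟨⟨⟩, w⟩, hw⟩, ⟨g, hg⟩⟩
    change G at z w g
    have hg' : z * g = g * w := hg
    -- The loop at the target is forced by the one at the source, so an object is just the pair `(g,
    -- z)`.
    obtain rfl : w = g⁻¹ * z * g := by rw [mul_assoc, hg', inv_mul_cancel_left]
    exact ⟨⟨(g, z), hz.choose_spec.1, hw.choose_spec.1⟩, rfl⟩
  act_mul x h k := by
    refine Subtype.ext (Prod.ext ?_ ?_)
    · simp only [LoopObj.act, Prod.fst_mul, Prod.snd_mul, Subgroup.coe_mul]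
      group
    · simp only [LoopObj.act, Prod.fst_mul, Subgroup.coe_mul]
      group
  hom {x y} h hy :=
    { left := ⟨⟨(h.1 : G), by
        change x.1.2 * (h.1 : G) = h.1 * y.1.2
        rw [hy]
        simp only [LoopObj.act]
        group⟩, x.2.1, h.1.2⟩
      right := ⟨⟨(h.2 : G), by
        change x.1.1⁻¹ * x.1.2 * x.1.1 * (h.2 : G) = h.2 * (y.1.1⁻¹ * y.1.2 * y.1.1)
        rw [hy]
        simp only [LoopObj.act]
        group⟩, x.2.2, h.2.2⟩
      w := by
        refine Loop.Hom.ext ?_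
        change (h.1 : G) * y.1.1 = x.1.1 * h.2
        rw [hy]
        simp only [LoopObj.act]
        group }
  label f := (eltA f.left, eltA f.right)
  label_hom _ _ := rfl
  exists_hom {x y} f := by
    have hw : (eltA f.left : G) * y.1.1 = x.1.1 * eltA f.right := congrArg Loop.Hom.map f.w
    have hl : x.1.2 * (eltA f.left : G) = eltA f.left * y.1.2 := f.left.1.comm
    refine ⟨(eltA f.left, eltA f.right), Subtype.ext (Prod.ext ?_ ?_), rfl⟩
    · simp only [LoopObj.act]
      rw [mul_assoc, ← hw, inv_mul_cancel_left]
    · simp only [LoopObj.act]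
      rw [mul_assoc, hl, inv_mul_cancel_left]
  hom_comp _ _ _ _ _ := rfl

end Presentations

/-! ## Weights of the cobordisms -/

section Weights

variable {G : Type*} [Group G] {A B : Subgroup G}

/-- Passing to arguments in `G` allows boundary and bulk terms to be normalised by the same group
identities. -/
theorem apply_pair_eq_evalOn (φ : (Fin 2 → A) → Circle) (a b : A) :
    φ ![a, b] = evalOn A φ ![(a : G), b] := by
  have h : ∀ i, (![(a : G), b] : Fin 2 → G) i ∈ A := fun i => by fin_cases i <;> simp
  rw [evalOn, dif_pos h]
  congr 1
  funext i
  fin_cases i <;> rfl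

theorem apply_triple_eq_evalOn (φ : (Fin 3 → A) → Circle) (a b c : A) :
    φ ![a, b, c] = evalOn A φ ![(a : G), b, c] := by
  have h : ∀ i, (![(a : G), b, c] : Fin 3 → G) i ∈ A := fun i => by fin_cases i <;> simp
  rw [evalOn, dif_pos h]
  congr 1
  funext i
  fin_cases i <;> rfl

variable {W : Type}

theorem differences_three (p : W × Bool → G) (v₀ v₁ v₂ : W × Bool) :
    differences p ![v₀, v₁, v₂] = ![(p v₀)⁻¹ * p v₁, (p v₁)⁻¹ * p v₂] := by
  funext i
  fin_cases i <;> rfl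

theorem differences_four (p : W × Bool → G) (v₀ v₁ v₂ v₃ : W × Bool) :
    differences p ![v₀, v₁, v₂, v₃] =
      ![(p v₀)⁻¹ * p v₁, (p v₁)⁻¹ * p v₂, (p v₂)⁻¹ * p v₃] := by
  funext i
  fin_cases i <;> rfl

theorem differences_five (p : W × Bool → G) (v₀ v₁ v₂ v₃ v₄ : W × Bool) :
    differences p ![v₀, v₁, v₂, v₃, v₄] =
      ![(p v₀)⁻¹ * p v₁, (p v₁)⁻¹ * p v₂, (p v₂)⁻¹ * p v₃, (p v₃)⁻¹ * p v₄] := by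
  funext i
  fin_cases i <;> rfl

set_option maxRecDepth 100000

theorem triangle_prism_facets : triangle.prism.facets =
    [(1, ![(0, false), (0, true), (1, true), (2, true)]),
      (-1, ![(0, false), (1, false), (1, true), (2, true)]),
      (1, ![(0, false), (1, false), (2, false), (2, true)])] := by
  decide +kernel

/-- The induced orientation is negative at this end and positive at the other, which is why `φ`
enters `ϑ` inverted and `ψ` does not. -/
theorem triangle_prism_side_false_facets : (triangle.prism.side false).facets =
    [(-1, ![(0, false), (1, false), (2, false)])] := by
  decide +kernel

theorem triangle_prism_side_true_facets : (triangle.prism.side true).facets =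
    [(1, ![(0, true), (1, true), (2, true)])] := by
  decide +kernel

theorem triangle_circle_facets : triangle.circle.facets =
    [(1, ![(0, false), (0, true), (1, true), (2, true)]),
      (-1, ![(0, false), (1, false), (1, true), (2, true)]),
      (1, ![(0, false), (1, false), (2, false), (2, true)])] := by
  decide +kernel

theorem triangle_circle_prism_facets : triangle.circle.prism.facets =
    triangle.circle.facets.flatMap fun f =>
      [(f.1, ![(f.2 0, false), (f.2 0, true), (f.2 1, true), (f.2 2, true), (f.2 3, true)]),
        (-f.1, ![(f.2 0, false), (f.2 1, false), (f.2 1, true), (f.2 2, true), (f.2 3, true)]),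
        (f.1, ![(f.2 0, false), (f.2 1, false), (f.2 2, false), (f.2 2, true), (f.2 3, true)]),
        (-f.1, ![(f.2 0, false), (f.2 1, false), (f.2 2, false), (f.2 3, false),
          (f.2 3, true)])] := by
  decide +kernel

theorem triangle_circle_prism_side_false_facets : (triangle.circle.prism.side false).facets =
    triangle.circle.facets.map fun f =>
      (-f.1, ![(f.2 0, false), (f.2 1, false), (f.2 2, false), (f.2 3, false)]) := by
  decide +kernel

theorem triangle_circle_prism_side_true_facets : (triangle.circle.prism.side true).facets =
    triangle.circle.facets.map fun f =>
      (f.1, ![(f.2 0, true), (f.2 1, true), (f.2 2, true), (f.2 3, true)]) := by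
  decide +kernel

/-- The three staircase tetrahedra give the three values of `α` in `ϑ`, one for each position of the
`𝕀`-edge among the two edges of the triangle; the two end triangles give `φ⁻¹` and `ψ`. -/
theorem potentialWeight_triangle_prism (α : (Fin 3 → G) → Circle) (φ : (Fin 2 → A) → Circle)
    (ψ : (Fin 2 → B) → Circle) (g : G) (h k : A × B) :
    potentialWeight triangle.prism α φ ψ (chainPotential g ![1, h, h * k]) =
      (groupPresentation A B).cochain (groupTwist α φ ψ) g h k := by
  have e : (groupPresentation A B).cochain (groupTwist α φ ψ) g h k =
      ψ ![h.2, k.2] / φ ![h.1, k.1] *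
        (α ![h.1, k.1, (k.1 : G)⁻¹ * ((h.1 : G)⁻¹ * g * h.2) * k.2] * α ![g, h.2, k.2] /
          α ![h.1, (h.1 : G)⁻¹ * g * h.2, k.2]) := rfl
  rw [e, apply_pair_eq_evalOn φ, apply_pair_eq_evalOn ψ]
  simp only [potentialWeight, triangle_prism_facets, triangle_prism_side_false_facets,
    triangle_prism_side_true_facets, List.map_cons, List.map_nil, List.prod_cons, List.prod_nil,
    differences_three, differences_four, chainPotential, cond_true, cond_false,
    Matrix.cons_val_zero, Matrix.cons_val_one, Matrix.cons_val, Units.val_neg, Units.val_one,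
    zpow_neg, zpow_one, Prod.fst_one, Prod.snd_one, OneMemClass.coe_one, inv_one, one_mul,
    mul_one, Prod.fst_mul, Prod.snd_mul, Subgroup.coe_mul, mul_inv_rev, mul_assoc,
    inv_mul_cancel_left]
  apply Additive.ofMul.injective
  simp only [ofMul_mul, ofMul_div, ofMul_inv]
  abel

/-- Each of the twelve 4-simplices orders two triangle edges, a circle edge and an `𝕀`-edge.
Grouping by the place of the `𝕀`-edge among the triangle edges gives three groups; within each, the
four places of the circle edge form one value of `T(π)`. The three tetrahedra at either end form
`T(l)⁻¹` and `T(m)`. -/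
theorem potentialWeight_triangle_circle_prism (π : (Fin 4 → G) → Circle)
    (l : (Fin 3 → A) → Circle) (m : (Fin 3 → B) → Circle) (x : LoopObj A B) (h k : A × B) :
    potentialWeight triangle.circle.prism π l m (loopChainPotential x ![1, h, h * k]) =
      (loopPresentation A B).cochain (loopTwist π l m) x h k := by
  let w : B := ⟨x.1.1⁻¹ * x.1.2 * x.1.1, x.2.2⟩
  have e : (loopPresentation A B).cochain (loopTwist π l m) x h k =
      transgress3 m w h.2 k.2 / transgress3 l ⟨x.1.2, x.2.1⟩ h.1 k.1 *
        (transgress4 π x.1.2 h.1 k.1 ((x.act h).act k).1.1 *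
          transgress4 π x.1.2 x.1.1 h.2 k.2 / transgress4 π x.1.2 h.1 (x.act h).1.1 k.2) := rfl
  simp only [e, transgress3, transgress4, apply_triple_eq_evalOn l, apply_triple_eq_evalOn m,
    potentialWeight, triangle_circle_prism_facets, triangle_circle_prism_side_false_facets,
    triangle_circle_prism_side_true_facets, triangle_circle_facets, List.flatMap_cons,
    List.flatMap_nil, List.cons_append, List.nil_append, List.append_nil, List.map_cons,
    List.map_nil, List.prod_cons, List.prod_nil,
    differences_four, differences_five, loopChainPotential, chainPotential, LoopObj.act, w,
    cond_true, cond_false, neg_neg,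
    Matrix.cons_val_zero, Matrix.cons_val_one, Matrix.cons_val, Units.val_neg, Units.val_one,
    zpow_neg, zpow_one, Prod.fst_one, Prod.snd_one, OneMemClass.coe_one, inv_one, one_mul,
    mul_one, Prod.fst_mul, Prod.snd_mul, Subgroup.coe_mul, InvMemClass.coe_inv, mul_inv_rev,
    mul_assoc, inv_mul_cancel_left, mul_inv_cancel_left]
  apply Additive.ofMul.injective
  simp only [ofMul_mul, ofMul_div, ofMul_inv]
  abel

end Weights

/-! ## The tube algebras -/

section TubeAlgebras

variable {G : Type*} [Group G] (A B : Subgroup G)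

theorem isSimplex_interval_path_fst :
    ∀ f ∈ interval.facets, path.IsSimplex (![0, 1] ∘ f.2) := by
  rintro f hf
  obtain rfl := List.mem_singleton.1 hf
  exact ⟨_, List.mem_cons_self, id, strictMono_id, by decide⟩

theorem isSimplex_interval_path_snd :
    ∀ f ∈ interval.facets, path.IsSimplex (![1, 2] ∘ f.2) := by
  rintro f hf
  obtain rfl := List.mem_singleton.1 hf
  exact ⟨(1, ![1, 2]), by decide, id, strictMono_id, by decide⟩

theorem isSimplex_interval_triangle :
    ∀ f ∈ interval.facets, triangle.IsSimplex (![0, 2] ∘ f.2) := by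
  rintro f hf
  obtain rfl := List.mem_singleton.1 hf
  exact ⟨_, List.mem_cons_self, ![0, 2], Complex.strictMono_pair (by decide), by decide⟩

theorem isSimplex_path_triangle :
    ∀ f ∈ path.facets, triangle.IsSimplex (id ∘ f.2) := by
  intro f hf
  simp only [path, List.mem_cons, List.not_mem_nil, or_false] at hf
  rcases hf with rfl | rfl
  · exact ⟨_, List.mem_cons_self, ![0, 1], Complex.strictMono_pair (by decide), by decide⟩
  · exact ⟨_, List.mem_cons_self, ![1, 2], Complex.strictMono_pair (by decide), by decide⟩

theorem isSimplex_path_pinched_src :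
    ∀ f ∈ path.facets, pinched.IsSimplex (![0, 1, 3] ∘ f.2) := by
  intro f hf
  simp only [path, List.mem_cons, List.not_mem_nil, or_false] at hf
  rcases hf with rfl | rfl
  · exact ⟨(1, ![0, 1, 2]), by decide, ![0, 1], Complex.strictMono_pair (by decide), by decide⟩
  · exact ⟨(-1, ![1, 2, 3]), by decide, ![0, 2], Complex.strictMono_pair (by decide), by decide⟩

theorem isSimplex_path_pinched_tgt :
    ∀ f ∈ path.facets, pinched.IsSimplex (![0, 2, 3] ∘ f.2) := by
  intro f hf
  simp only [path, List.mem_cons, List.not_mem_nil, or_false] at hf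
  rcases hf with rfl | rfl
  · exact ⟨(1, ![0, 1, 2]), by decide, ![0, 2], Complex.strictMono_pair (by decide), by decide⟩
  · exact ⟨(-1, ![1, 2, 3]), by decide, ![1, 2], Complex.strictMono_pair (by decide), by decide⟩

/-- The colourings of the complexes defining the `(2+1)`-dimensional tube algebra. -/
noncomputable def chainData2 :
    ChainData (fun (g : G) (k : A × B) => (k.1 : G)⁻¹ * g * k.2) A B ![0, 1] ![1, 2]
      projector2 fusion2 where
  cT := chainColouring isChain_interval
  cS := chainColouring isChain_path
  cQ := chainColouring isChain_triangle
  cP := chainColouring isChain_pinched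
  bijective_T := chainColouring_bijective _
  bijective_S := chainColouring_bijective _
  bijective_Q := chainColouring_bijective _
  bijective_P := chainColouring_bijective _
  translate := chainColouring_translate _
  restrict_fst := chainColouring_restrictsTo_iff _ _ isSimplex_interval_path_fst
  restrict_snd := chainColouring_restrictsTo_iff _ _ isSimplex_interval_path_snd
  restrict_P_src := chainColouring_restrictsTo_iff _ _ isSimplex_path_pinched_src
  restrict_P_tgt := chainColouring_restrictsTo_iff _ _ isSimplex_path_pinched_tgt
  restrict_Q_src := chainColouring_restrictsTo_iff _ _ isSimplex_path_triangle
  restrict_Q_tgt := chainColouring_restrictsTo_iff _ _ isSimplex_interval_triangle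

/-- The colourings of the complexes defining the `(3+1)`-dimensional tube algebra. -/
noncomputable def chainData3 :
    ChainData (LoopObj.act (A := A) (B := B)) A B (Prod.map ![0, 1] id) (Prod.map ![1, 2] id)
      projector3 fusion3 where
  cT := loopChainColouring interval
  cS := loopChainColouring path
  cQ := loopChainColouring triangle
  cP := loopChainColouring pinched
  bijective_T := loopChainColouring_bijective isChain_interval
  bijective_S := loopChainColouring_bijective isChain_path
  bijective_Q := loopChainColouring_bijective isChain_triangle
  bijective_P := loopChainColouring_bijective isChain_pinched
  translate := loopChainColouring_translate _
  restrict_fst := loopChainColouring_restrictsTo_iff isSimplex_interval_path_fst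
  restrict_snd := loopChainColouring_restrictsTo_iff isSimplex_interval_path_snd
  restrict_P_src := loopChainColouring_restrictsTo_iff isSimplex_path_pinched_src
  restrict_P_tgt := loopChainColouring_restrictsTo_iff isSimplex_path_pinched_tgt
  restrict_Q_src := loopChainColouring_restrictsTo_iff isSimplex_path_triangle
  restrict_Q_tgt := loopChainColouring_restrictsTo_iff isSimplex_interval_triangle

variable {A B}

theorem exists_eq_mul {H : Type*} [Group H] (h l : H) : ∃ k, l = h * k :=
  ⟨h⁻¹ * l, (mul_inv_cancel_left h l).symm⟩

theorem weight_fusion2 (α : (Fin 3 → G) → Circle) (φ : (Fin 2 → A) → Circle)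
    (ψ : (Fin 2 → B) → Circle) (g : G) (h l : A × B) :
    weight α φ ψ ((chainData2 A B).cQ g ![1, h, l]) =
      (groupPresentation A B).cochain (groupTwist α φ ψ) g h (h⁻¹ * l) := by
  obtain ⟨k, rfl⟩ := exists_eq_mul h l
  rw [inv_mul_cancel_left]
  exact (weight_ofPotential α φ ψ (isPotential_chain isChain_triangle _ _)).trans
     (potentialWeight_triangle_prism α φ ψ g h k)

theorem weight_fusion3 (π : (Fin 4 → G) → Circle) (l : (Fin 3 → A) → Circle)
    (m : (Fin 3 → B) → Circle) (x : LoopObj A B) (h j : A × B) :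
    weight π l m ((chainData3 A B).cQ x ![1, h, j]) =
      (loopPresentation A B).cochain (loopTwist π l m) x h (h⁻¹ * j) := by
  obtain ⟨k, rfl⟩ := exists_eq_mul h j
  rw [inv_mul_cancel_left]
  exact (weight_ofPotential π l m (isPotential_loopChain _ _)).trans
     (potentialWeight_triangle_circle_prism π l m x h k)

set_option maxRecDepth 100000

theorem comp_pinched_fst {H : Type*} (a b c d : H) : ![a, b, c, d] ∘ ![0, 1, 2] = ![a, b, c] := by
  funext i
  fin_cases i <;> rfl

theorem comp_pinched_snd {H : Type*} [Group H] (h j l : H) :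
    ![1, h, j, l] ∘ ![1, 2, 3] = fun i => h * (![1, h⁻¹ * j, h⁻¹ * l] : Fin 3 → H) i := by
  funext i
  fin_cases i
  · exact (mul_one h).symm
  · exact (mul_inv_cancel_left h j).symm
  · exact (mul_inv_cancel_left h l).symm

theorem weight_projector2 (α : (Fin 3 → G) → Circle) (φ : (Fin 2 → A) → Circle)
    (ψ : (Fin 2 → B) → Circle) (g : G) (h j l : A × B) :
    weight α φ ψ ((chainData2 A B).cP g ![1, h, j, l]) =
      (groupPresentation A B).cochain (groupTwist α φ ψ) g h (h⁻¹ * j) /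
        (groupPresentation A B).cochain (groupTwist α φ ψ) ((h.1 : G)⁻¹ * g * h.2)
          (h⁻¹ * j) (j⁻¹ * l) := by
  have e : ∀ s : Fin 3 → Fin 4,
      potentialWeight triangle.prism α φ ψ (chainPotential g ![1, h, j, l] ∘ Prod.map s id) =
      weight α φ ψ ((chainData2 A B).cQ g (![1, h, j, l] ∘ s)) := fun s =>
    (weight_ofPotential α φ ψ (isPotential_chain isChain_triangle g (![1, h, j, l] ∘ s))).symm
  refine (weight_ofPotential α φ ψ (isPotential_chain isChain_pinched _ _)).trans ?_
  -- The projector is the triangle on vertices `0, 1, 2` minus the one on `1, 2, 3`.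
  refine (potentialWeight_eq_div (L := triangle.prism) (Prod.map ![0, 1, 2] id)
    (Prod.map ![1, 2, 3] id) (by decide +kernel) (by decide +kernel) α φ ψ _).trans ?_
  rw [e, e, comp_pinched_fst, comp_pinched_snd, weight_fusion2]
  congr 1
  -- The second triangle starts at vertex `1`; translating by `h` moves the starting object along.
  refine (congrArg _ (chainColouring_translate isChain_triangle g h _)).trans ?_
  refine (weight_fusion2 α φ ψ _ (h⁻¹ * j) (h⁻¹ * l)).trans ?_
  congr 1
  group

theorem weight_projector3 (π : (Fin 4 → G) → Circle) (l : (Fin 3 → A) → Circle)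
    (m : (Fin 3 → B) → Circle) (x : LoopObj A B) (h j k : A × B) :
    weight π l m ((chainData3 A B).cP x ![1, h, j, k]) =
      (loopPresentation A B).cochain (loopTwist π l m) x h (h⁻¹ * j) /
        (loopPresentation A B).cochain (loopTwist π l m) (x.act h) (h⁻¹ * j) (j⁻¹ * k) := by
  have e : ∀ s : Fin 3 → Fin 4,
      potentialWeight triangle.circle.prism π l m
        (loopChainPotential x ![1, h, j, k] ∘ Prod.map (Prod.map s id) id) =
      weight π l m ((chainData3 A B).cQ x (![1, h, j, k] ∘ s)) := fun s =>
    (weight_ofPotential π l m (isPotential_loopChain x (![1, h, j, k] ∘ s))).symm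
  refine (weight_ofPotential π l m (isPotential_loopChain _ _)).trans ?_
  refine (potentialWeight_eq_div (L := triangle.circle.prism)
    (Prod.map (Prod.map ![0, 1, 2] id) id) (Prod.map (Prod.map ![1, 2, 3] id) id)
    (by decide +kernel) (by decide +kernel) π l m _).trans ?_
  rw [e, e, comp_pinched_fst, comp_pinched_snd, weight_fusion3]
  congr 1
  refine (congrArg _ (loopChainColouring_translate triangle x h _)).trans ?_
  refine (weight_fusion3 π l m _ (h⁻¹ * j) (h⁻¹ * k)).trans ?_
  congr 1
  group

theorem isNormalizedCocycle2_groupTwist {α : (Fin 3 → G) → Circle} {φ : (Fin 2 → A) → Circle}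
    {ψ : (Fin 2 → B) → Circle} (hα : IsNormalizedCocycle α) (hφ : IsBoundaryCondition α A φ)
    (hψ : IsBoundaryCondition α B ψ) : IsNormalizedCocycle2 (groupTwist α φ ψ) :=
  isNormalizedCocycle2_relTwist (isNormalizedCocycle3_deloop3 hα)
    (isTwistedSubgroupoid_deloop2 hφ) (isTwistedSubgroupoid_deloop2 hψ)
    (fun _ _ _ => hφ.1 _ ⟨0, rfl⟩) (fun _ _ _ => hφ.1 _ ⟨1, rfl⟩)
    (fun _ _ _ => hψ.1 _ ⟨0, rfl⟩) (fun _ _ _ => hψ.1 _ ⟨1, rfl⟩)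

theorem isNormalizedCocycle2_loopTwist {π : (Fin 4 → G) → Circle} {l : (Fin 3 → A) → Circle}
    {m : (Fin 3 → B) → Circle} (hπ : IsNormalizedCocycle π) (hl : IsBoundaryCondition π A l)
    (hm : IsBoundaryCondition π B m) : IsNormalizedCocycle2 (loopTwist π l m) :=
  isNormalizedCocycle2_relTwist (isNormalizedCocycle3_T4 hπ)
    (isTwistedSubgroupoid_T3 hl) (isTwistedSubgroupoid_T3 hm)
    (fun _ _ f => T3_id_left hl.1 f) (fun _ _ f => T3_id_right hl.1 f)
    (fun _ _ f => T3_id_left hm.1 f) (fun _ _ f => T3_id_right hm.1 f)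

theorem chainData2_labels (g : G) (h : A × B) :
    ((chainData2 A B).cT g ![1, h]).col (0, false) (0, true) = g ∧
    ((chainData2 A B).cT g ![1, h]).col (0, false) (1, false) = h.1 ∧
    ((chainData2 A B).cT g ![1, h]).col (0, true) (1, true) = h.2 := by
  have hv : tube2.IsSimplex ![(0, false), (0, true)] :=
    (isChain_interval.vertex 0).prism_vertical
  have he : ∀ b, tube2.IsSimplex ![(0, b), (1, b)] := (isChain_interval.edge 0).prism_horizontal
  refine ⟨(Colouring.ofPotential_col (isPotential_chain isChain_interval _ _) hv).trans ?_,
    (Colouring.ofPotential_col (isPotential_chain isChain_interval _ _) (he false)).trans ?_,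
    (Colouring.ofPotential_col (isPotential_chain isChain_interval _ _) (he true)).trans ?_⟩ <;> simp [chainPotential]

theorem chainData3_labels (x : LoopObj A B) (h : A × B) :
    ((chainData3 A B).cT x ![1, h]).col ((0, false), false) ((0, false), true) = x.1.1 ∧
    ((chainData3 A B).cT x ![1, h]).col ((0, false), false) ((0, true), false) = x.1.2 ∧
    ((chainData3 A B).cT x ![1, h]).col ((0, false), true) ((0, true), true) =
      x.1.1⁻¹ * x.1.2 * x.1.1 ∧
    ((chainData3 A B).cT x ![1, h]).col ((0, false), false) ((1, false), false) = h.1 ∧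
    ((chainData3 A B).cT x ![1, h]).col ((0, false), true) ((1, false), true) = h.2 := by
  have hI : tube3.IsSimplex ![((0, false), false), ((0, false), true)] :=
    ((isChain_interval.vertex 0).prism_point false).circle.prism_vertical
  have hS : ∀ b, tube3.IsSimplex ![((0, false), b), ((0, true), b)] :=
    (isChain_interval.vertex 0).prism_vertical.circle.prism_horizontal
  have he : ∀ b, tube3.IsSimplex ![((0, false), b), ((1, false), b)] :=
    ((isChain_interval.edge 0).prism_horizontal false).circle.prism_horizontal
  refine ⟨(Colouring.ofPotential_col (isPotential_loopChain _ _) hI).trans ?_,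
    (Colouring.ofPotential_col (isPotential_loopChain _ _) (hS false)).trans ?_,
    (Colouring.ofPotential_col (isPotential_loopChain _ _) (hS true)).trans ?_,
    (Colouring.ofPotential_col (isPotential_loopChain _ _) (he false)).trans ?_,
    (Colouring.ofPotential_col (isPotential_loopChain _ _) (he true)).trans ?_⟩ <;>
  simp [loopChainPotential, chainPotential, mul_assoc]

variable [Finite G]

theorem sqrt_card_ne_zero (A : Subgroup G) : √(Nat.card A : ℝ) ≠ 0 :=
  (Real.sqrt_pos.2 (Nat.cast_pos.2 Nat.card_pos)).ne'

/-- The projector contributes `(|A||B|)⁻¹`, cancelled by its `|A × B|` equal terms; only the square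
roots from the change of triangulation survive. -/
theorem normalisation_mul {k : ℕ} {U U' W₁ W₂ : Type} [DecidableEq W₁] [DecidableEq W₂]
    [DecidableEq U] [DecidableEq U'] {S : Complex (k + 2) (U × Bool)}
    {T : Complex (k + 2) (U' × Bool)} {P : Cobordism S S W₁} {Q : Cobordism S T W₂}
    (hP : twiceExponent P.bulk S S = 0 ∧
      ∀ b, twiceExponent (P.bulk.side b) (S.side b) (S.side b) = 2)
    (hQ : twiceExponent Q.bulk S T = 0 ∧
      ∀ b, twiceExponent (Q.bulk.side b) (S.side b) (T.side b) = 1) (A B : Subgroup G) :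
    normalisation Q A B * (normalisation P A B * Nat.card (A × B)) =
      (√(Nat.card A : ℝ) * √(Nat.card B : ℝ))⁻¹ := by
  have hA := sqrt_card_ne_zero A
  have hB := sqrt_card_ne_zero B
  rw [normalisation, normalisation, hP.1, hP.2, hP.2, hQ.1, hQ.2, hQ.2, Nat.card_prod,
    Nat.cast_mul]
  have hA' := Real.sq_sqrt (Nat.cast_nonneg (α := ℝ) (Nat.card A))
  have hB' := Real.sq_sqrt (Nat.cast_nonneg (α := ℝ) (Nat.card B))
  generalize √(Nat.card A : ℝ) = a at *
  generalize √(Nat.card B : ℝ) = b at *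
  rw [← hA', ← hB']
  field_simp

end TubeAlgebras

/-! ## The inclusion of `G_{AB}` into `ΛG_{ΛA ΛB}` -/

section Inclusion

variable {G : Type*} [Group G] (A B : Subgroup G)

/-- The inclusion of the delooping of `A` into `ΛA`, as the automorphisms of the trivial loop. -/
def trivialLoop (A : Subgroup G) : (deloopSubgroup A).objs ⥤ (loopA A).objs where
  obj X := ⟨⟨X.1, 𝟙 X.1⟩, ⟨𝟙 _, A.one_mem, A.one_mem⟩⟩
  map f := ⟨⟨f.1, (Category.id_comp f.1).trans (Category.comp_id f.1).symm⟩, A.one_mem, f.2⟩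
  map_id _ := rfl
  map_comp _ _ := rfl

/-- The inclusion of `G_{AB}` into `ΛG_{ΛA ΛB}`. -/
def relInclusion : RelGroupoid (deloopSubgroup A) (deloopSubgroup B) ⥤
    RelGroupoid (loopA A) (loopA B) where
  obj X :=
    { left := (trivialLoop A).obj X.left
      right := (trivialLoop B).obj X.right
      hom := ⟨X.hom, (Category.id_comp X.hom).trans (Category.comp_id X.hom).symm⟩ }
  map f :=
    { left := (trivialLoop A).map f.left
      right := (trivialLoop B).map f.right
      w := Loop.Hom.ext f.w }
  map_id _ := rfl
  map_comp _ _ := rfl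

/-- Commuting with trivial loops is no condition, so a morphism between included objects is just a
pair of elements of `A` and `B` making the square in `G` commute. -/
theorem relInclusion_full : (relInclusion A B).Full where
  map_surjective f :=
    ⟨{ left := ⟨f.left.1.map, f.left.2.2⟩
       right := ⟨f.right.1.map, f.right.2.2⟩
       w := congrArg Loop.Hom.map f.w }, rfl⟩

theorem relInclusion_faithful : (relInclusion A B).Faithful where
  map_injective {X Y} f f' h := by
    refine CommaMorphism.ext (Subtype.ext ?_) (Subtype.ext ?_)
    · exact congrArg (fun k : (relInclusion A B).obj X ⟶ (relInclusion A B).obj Y =>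
        (CommaMorphism.left k).1.map) h
    · exact congrArg (fun k : (relInclusion A B).obj X ⟶ (relInclusion A B).obj Y =>
        (CommaMorphism.right k).1.map) h

theorem relInclusion_obj_injective : Function.Injective (relInclusion A B).obj := by
  rintro ⟨⟨⟨⟩, _⟩, ⟨⟨⟩, _⟩, g⟩ ⟨⟨⟨⟩, _⟩, ⟨⟨⟩, _⟩, g'⟩ h
  obtain rfl : g = g' :=
    congrArg (fun Y : RelGroupoid (loopA A) (loopA B) => eltG Y.hom) h
  rfl

theorem exists_relInclusion_obj_eq_iff (Y : RelGroupoid (loopA A) (loopA B)) :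
    (∃ X, (relInclusion A B).obj X = Y) ↔ fluxG Y.left.1 = 1 ∧ fluxG Y.right.1 = 1 := by
  constructor
  · rintro ⟨X, rfl⟩
    exact ⟨rfl, rfl⟩
  · obtain ⟨⟨⟨⟨⟩, z⟩, hz⟩, ⟨⟨⟨⟩, w⟩, hw⟩, ⟨g, hg⟩⟩ := Y
    change G at z w
    rintro ⟨h, h'⟩
    obtain rfl : z = 1 := h
    obtain rfl : w = 1 := h'
    exact ⟨{ left := ⟨⟨⟩, ⟨(1 : G), A.one_mem⟩⟩
             right := ⟨⟨⟩, ⟨(1 : G), B.one_mem⟩⟩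
             hom := g }, rfl⟩

end Inclusion

end GappedTube

/-! ### The main theorem. -/

theorem mainTheorem1 {G : Type*} [Group G] [Finite G] (A B : Subgroup G) :
    -- the `(3+1)`-dimensional tube algebra
    (∀ (π : (Fin 4 → G) → Circle) (l : (Fin 3 → A) → Circle) (m : (Fin 3 → B) → Circle),
      GappedTube.IsNormalizedCocycle π →
      GappedTube.IsBoundaryCondition π A l →
      GappedTube.IsBoundaryCondition π B m →
        GappedTube.IsNormalizedCocycle3 (GappedTube.T4 π) ∧
        GappedTube.IsTwistedSubgroupoid (GappedTube.T4 π) (GappedTube.loopA A)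
          (GappedTube.T3 l) ∧
        GappedTube.IsTwistedSubgroupoid (GappedTube.T4 π) (GappedTube.loopA B)
          (GappedTube.T3 m) ∧
        GappedTube.IsNormalizedCocycle2 (GappedTube.loopTwist π l m) ∧
        GappedTube.IsUnitalAssoc (GappedTube.twistedProduct (GappedTube.loopTwist π l m)) ∧
        GappedTube.IsUnitalAssoc (GappedTube.tubeProduct3 π l m) ∧
        ∃ (e : GappedTube.Colouring GappedTube.tube3 A B ≃
              GappedTube.Mor
                (GappedTube.RelGroupoid (GappedTube.loopA A) (GappedTube.loopA B)))
          (Φ : GappedTube.States GappedTube.tube3 A B ≃ₗ[ℂ]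
              (GappedTube.Mor
                (GappedTube.RelGroupoid (GappedTube.loopA A) (GappedTube.loopA B)) →₀ ℂ)),
          (∀ c,
            GappedTube.eltG (e c).src.hom = c.col ((0, false), false) ((0, false), true) ∧
            GappedTube.fluxG (e c).src.left.1 = c.col ((0, false), false) ((0, true), false) ∧
            GappedTube.fluxG (e c).src.right.1 = c.col ((0, false), true) ((0, true), true) ∧
            (GappedTube.eltA (e c).hom.left : G) =
              c.col ((0, false), false) ((1, false), false) ∧
            (GappedTube.eltA (e c).hom.right : G) =
              c.col ((0, false), true) ((1, false), true)) ∧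
          (∀ c, Φ (Finsupp.single c 1) =
            (((√(Nat.card A : ℝ) * √(Nat.card B : ℝ))⁻¹ : ℝ) : ℂ) • Finsupp.single (e c) 1) ∧
          ∀ x y, Φ (GappedTube.tubeProduct3 π l m x y) =
            GappedTube.twistedProduct (GappedTube.loopTwist π l m) (Φ x) (Φ y)) ∧
    -- the `(2+1)`-dimensional tube algebra: the same construction on the one-object groupoid
    (∀ (α : (Fin 3 → G) → Circle) (φ : (Fin 2 → A) → Circle) (ψ : (Fin 2 → B) → Circle),
      GappedTube.IsNormalizedCocycle α →
      GappedTube.IsBoundaryCondition α A φ →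
      GappedTube.IsBoundaryCondition α B ψ →
        GappedTube.IsNormalizedCocycle2 (GappedTube.groupTwist α φ ψ) ∧
        GappedTube.IsUnitalAssoc (GappedTube.twistedProduct (GappedTube.groupTwist α φ ψ)) ∧
        GappedTube.IsUnitalAssoc (GappedTube.tubeProduct2 α φ ψ) ∧
        ∃ (e : GappedTube.Colouring GappedTube.tube2 A B ≃
              GappedTube.Mor (GappedTube.RelGroupoid (GappedTube.deloopSubgroup A)
                (GappedTube.deloopSubgroup B)))
          (Φ : GappedTube.States GappedTube.tube2 A B ≃ₗ[ℂ]
              (GappedTube.Mor (GappedTube.RelGroupoid (GappedTube.deloopSubgroup A)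
                (GappedTube.deloopSubgroup B)) →₀ ℂ)),
          (∀ c,
            GappedTube.Deloop.elt (e c).src.hom = c.col (0, false) (0, true) ∧
            (GappedTube.eltD (e c).hom.left : G) = c.col (0, false) (1, false) ∧
            (GappedTube.eltD (e c).hom.right : G) = c.col (0, true) (1, true)) ∧
          (∀ c, Φ (Finsupp.single c 1) =
            (((√(Nat.card A : ℝ) * √(Nat.card B : ℝ))⁻¹ : ℝ) : ℂ) • Finsupp.single (e c) 1) ∧
          ∀ x y, Φ (GappedTube.tubeProduct2 α φ ψ x y) =
            GappedTube.twistedProduct (GappedTube.groupTwist α φ ψ) (Φ x) (Φ y)) ∧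
    -- `G_{AB}` is the restriction of `ΛG_{ΛA ΛB}` to source and target equal to the identity
    (∃ J : GappedTube.RelGroupoid (GappedTube.deloopSubgroup A) (GappedTube.deloopSubgroup B) ⥤
          GappedTube.RelGroupoid (GappedTube.loopA A) (GappedTube.loopA B),
        J.Full ∧ J.Faithful ∧ Function.Injective J.obj ∧
        (∀ Y, (∃ X, J.obj X = Y) ↔
          GappedTube.fluxG Y.left.1 = 1 ∧ GappedTube.fluxG Y.right.1 = 1) ∧
        (∀ X, GappedTube.eltG (J.obj X).hom = GappedTube.Deloop.elt X.hom) ∧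
        ∀ ⦃X Y⦄ (f : X ⟶ Y),
          GappedTube.eltA (J.map f).left = GappedTube.eltD f.left ∧
          GappedTube.eltA (J.map f).right = GappedTube.eltD f.right) := by
  refine ⟨fun π l m hπ hl hm => ?_, fun α φ ψ hα hφ hψ => ?_, ?_⟩
  · have hθ := GappedTube.isNormalizedCocycle2_loopTwist hπ hl hm
    obtain ⟨h₁, h₂, e, Φ, he, hΦ, hmul⟩ := GappedTube.exists_tubeAlgebra_iso
      (GappedTube.chainData3 A B) π l m (GappedTube.loopPresentation A B) hθ
      (GappedTube.weight_fusion3 π l m) (GappedTube.weight_projector3 π l m)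
      (inv_ne_zero (mul_ne_zero (GappedTube.sqrt_card_ne_zero A) (GappedTube.sqrt_card_ne_zero B)))
      (GappedTube.normalisation_mul GappedTube.exponent_projector3
        GappedTube.exponent_fusion3 A B)
    refine ⟨GappedTube.isNormalizedCocycle3_T4 hπ, GappedTube.isTwistedSubgroupoid_T3 hl,
      GappedTube.isTwistedSubgroupoid_T3 hm, hθ, h₁, h₂, e, Φ, fun c => ?_, hΦ, hmul⟩
    -- The labels are compared on the parametrised colourings, where the corresponding morphism is
    -- explicit.
    obtain ⟨⟨x, h⟩, rfl⟩ := (GappedTube.chainData3 A B).tube_bijective.2 c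
    obtain ⟨k₁, k₂, k₃, k₄, k₅⟩ := GappedTube.chainData3_labels x h
    have hM := he x h
    simp only [k₁, k₂, k₃, k₄, k₅]
    -- The types of the labels depend on the morphism; generalising it allows replacement by the
    -- explicit one, on which all five labels agree by definition.
    generalize e ((GappedTube.chainData3 A B).cT x ![1, h]) = M at hM ⊢
    subst hM
    exact ⟨rfl, rfl, rfl, rfl, rfl⟩
  · have hθ := GappedTube.isNormalizedCocycle2_groupTwist hα hφ hψ
    obtain ⟨h₁, h₂, e, Φ, he, hΦ, hmul⟩ := GappedTube.exists_tubeAlgebra_iso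
      (GappedTube.chainData2 A B) α φ ψ (GappedTube.groupPresentation A B) hθ
      (GappedTube.weight_fusion2 α φ ψ) (GappedTube.weight_projector2 α φ ψ)
      (inv_ne_zero (mul_ne_zero (GappedTube.sqrt_card_ne_zero A) (GappedTube.sqrt_card_ne_zero B)))
      (GappedTube.normalisation_mul GappedTube.exponent_projector2
        GappedTube.exponent_fusion2 A B)
    refine ⟨hθ, h₁, h₂, e, Φ, fun c => ?_, hΦ, hmul⟩
    obtain ⟨⟨g, h⟩, rfl⟩ := (GappedTube.chainData2 A B).tube_bijective.2 c
    obtain ⟨k₁, k₂, k₃⟩ := GappedTube.chainData2_labels g h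
    have hM := he g h
    simp only [k₁, k₂, k₃]
    generalize e ((GappedTube.chainData2 A B).cT g ![1, h]) = M at hM ⊢
    subst hM
    exact ⟨rfl, rfl, rfl⟩
  · exact ⟨GappedTube.relInclusion A B, GappedTube.relInclusion_full A B,
      GappedTube.relInclusion_faithful A B, GappedTube.relInclusion_obj_injective A B,
      GappedTube.exists_relInclusion_obj_eq_iff A B, fun _ => rfl, fun _ _ _ => ⟨rfl, rfl⟩⟩
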